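/- Let $d\ge 1$, let $c_d=\Gamma(\frac{d+1}{2})/\pi^{\frac{d+1}{2}}$, let $\mu$ be the standard Cauchy probability measure on $\mathbb R^d$, with Lebesgue density $p(x)=c_d(1+\|x\|^2)^{-\frac{d+1}{2}}$, and let $\nu(du)=c_d\|u\|^{-d-1}du$ be its Lévy measure. For suitable real functions on $\mathbb R^d$ put $$\mathcal A f(x)=\int_{\mathbb R^d}\bigl(f(x+u)-f(x)-\mathbf 1_{\|u\|\le 1}\langle u,\nabla f(x)\rangle\bigr)\,\nu(du),$$ $$\Gamma(f,g)(x)=\int_{\mathbb R^d}(f(x+u)-f(x))(g(x+u)-g(x))\,\nu(du).$$ Let $\mathcal L_1$ be the operator (the generator of the "carré de Mehler" semigroup of $\mu$) given on the real Schwartz space $\mathcal S(\mathbb R^d)$ by $$\mathcal L_1 f=2\,\mathcal A f+\frac1p\,\Gamma(p,f).$$ For $R>0$ and $1\le j\le d$ let $g_{R,j}(x)=x_j\exp(-\|x\|^2/R^2)$. Then: 1. For every $j\in\{1,\dots,d\}$, $$\lim_{R\to+\infty}\frac{\|\mathcal L_1 g_{R,j}+g_{R,j}\|_{L^2(\mu)}^2}{\|g_{R,j}\|_{L^2(\mu)}^2}=0.$$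 2. $\mathcal L_1$ is a well-defined linear operator on $L^2(\mu)$ with domain $\mathcal S(\mathbb R^d)$, and $-1$ belongs to its approximate point spectrum, as well as to that of every linear operator on $L^2(\mu)$ that extends it; here $\lambda$ is in the approximate point spectrum of an operator $T$ with domain $D(T)$ if there are $f_n\in D(T)$ with $\|f_n\|_{L^2(\mu)}=1$ and $\|Tf_n-\lambda f_n\|_{L^2(\mu)}\to 0$. 3. One has $$U_1(\mu):=\sup\left\{\frac{\|f\|_{L^2(\mu)}}{\|\mathcal L_1 f\|_{L^2(\mu)}} : f\in\mathcal S(\mathbb R^d)\setminus\{0\},\ \int_{\mathbb R^d} f\,d\mu=0\right\}=1.$$ -/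

import Mathlib

open MeasureTheory Filter Topology
open scoped ENNReal

noncomputable section

namespace CauchyMehler

/-- The constant `Γ((d+1)/2) / π^((d+1)/2)`. It normalizes both the density of the standard
Cauchy law on `ℝ^d` and its Lévy measure. -/
def cauchyConst (d : ℕ) : ℝ :=
  Real.Gamma (((d : ℝ) + 1) / 2) / Real.pi ^ (((d : ℝ) + 1) / 2)

/-- The Lebesgue density of the standard Cauchy law on `ℝ^d`. -/
def cauchyDensity (d : ℕ) (x : EuclideanSpace ℝ (Fin d)) : ℝ :=
  cauchyConst d / (1 + ‖x‖ ^ 2) ^ (((d : ℝ) + 1) / 2)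

/-- The standard Cauchy probability measure on `ℝ^d`. -/
def cauchyMeasure (d : ℕ) : Measure (EuclideanSpace ℝ (Fin d)) :=
  volume.withDensity fun x => ENNReal.ofReal (cauchyDensity d x)

/-- The Lévy measure of the standard Cauchy law, that is, `c_d du / ‖u‖^(d+1)`. -/
def levyMeasure (d : ℕ) : Measure (EuclideanSpace ℝ (Fin d)) :=
  volume.withDensity fun u => ENNReal.ofReal (cauchyConst d / ‖u‖ ^ (d + 1))

/-- The nonlocal operator
`A f (x) = ∫ (f (x+u) - f x - 1_{‖u‖ ≤ 1} ⟨u, ∇f x⟩) ν(du)` (minus the square root of `-Δ`);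
`⟨u, ∇f x⟩` is written `fderiv ℝ f x u`. -/
def opA (d : ℕ) (f : EuclideanSpace ℝ (Fin d) → ℝ) (x : EuclideanSpace ℝ (Fin d)) : ℝ :=
  ∫ u, (f (x + u) - f x -
    (Metric.closedBall (0 : EuclideanSpace ℝ (Fin d)) 1).indicator (fun v => fderiv ℝ f x v) u)
    ∂(levyMeasure d)

/-- The squared field operator `Γ(f,g)(x) = ∫ (f (x+u) - f x) (g (x+u) - g x) ν(du)`. -/
def squaredField (d : ℕ) (f g : EuclideanSpace ℝ (Fin d) → ℝ)
    (x : EuclideanSpace ℝ (Fin d)) : ℝ :=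
  ∫ u, (f (x + u) - f x) * (g (x + u) - g x) ∂(levyMeasure d)

/-- The generator of the "carré de Mehler" semigroup, `L f = 2 A f + Γ(p, f) / p`. -/
def opL (d : ℕ) (f : EuclideanSpace ℝ (Fin d) → ℝ) (x : EuclideanSpace ℝ (Fin d)) : ℝ :=
  2 * opA d f x + 1 / cauchyDensity d x * squaredField d (cauchyDensity d) f x

/-- The `j`-th coordinate of the vector field `x ↦ x exp(-‖x‖²/R²)`. -/
def truncCoord (d : ℕ) (R : ℝ) (j : Fin d) (x : EuclideanSpace ℝ (Fin d)) : ℝ :=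
  x j * Real.exp (-(‖x‖ ^ 2 / R ^ 2))

/-- `U(μ) = sup ‖f‖_{L²(μ)} / ‖L f‖_{L²(μ)}` over the nonzero Schwartz functions `f` with
`∫ f dμ = 0`, as an extended nonnegative real number (so that a positive number divided by `0`
is `∞`). -/
def functionalU (d : ℕ) (μ : Measure (EuclideanSpace ℝ (Fin d))) : ℝ≥0∞ :=
  ⨆ (f : SchwartzMap (EuclideanSpace ℝ (Fin d)) ℝ) (_ : f ≠ 0) (_ : ∫ x, f x ∂μ = 0),
    eLpNorm (fun x => f x) 2 μ / eLpNorm (opL d (fun x => f x)) 2 μ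

/-- `T` is the operator `L` on the real Hilbert space `L²` of the standard Cauchy law with domain
exactly the (classes of) Schwartz functions. -/
def IsSchwartzRealization (d : ℕ)
    (T : Lp ℝ 2 (cauchyMeasure d) →ₗ.[ℝ] Lp ℝ 2 (cauchyMeasure d)) : Prop :=
  (∀ F : Lp ℝ 2 (cauchyMeasure d), F ∈ T.domain ↔
    ∃ f : SchwartzMap (EuclideanSpace ℝ (Fin d)) ℝ, F =ᵐ[cauchyMeasure d] fun x => f x) ∧
  ∀ (F : T.domain) (f : SchwartzMap (EuclideanSpace ℝ (Fin d)) ℝ),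
    (F : Lp ℝ 2 (cauchyMeasure d)) =ᵐ[cauchyMeasure d] (fun x => f x) →
      T F =ᵐ[cauchyMeasure d] opL d (fun x => f x)

/-- The (real) approximate point spectrum of a partially defined linear operator. -/
def approxPointSpectrum {E : Type*} [NormedAddCommGroup E] [NormedSpace ℝ E]
    (T : E →ₗ.[ℝ] E) : Set ℝ :=
  {c | ∃ u : ℕ → T.domain, (∀ n, ‖(u n : E)‖ = 1) ∧
    Tendsto (fun n => ‖T (u n) - c • (u n : E)‖) atTop (𝓝 0)}

end CauchyMehler

end

noncomputable section

namespace CauchyMehler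

open Set

/-! ### A classical integral and the characteristic function of the Cauchy law -/

/-! Two estimates carry the theorem: a spectral gap with constant one for the upper bound on
`functionalU`, and a uniform pointwise bound showing that `opL` is nearly `-1` on slowly growing
centred functions.

Spectral gap. The Cauchy laws form a convolution semigroup, because the characteristic function is
`exp (-‖ξ‖)`. Hence the law of scale one is an `(n+1)`-fold convolution of the law of scale
`1/(n+1)`. Tensorization of the variance bounds the variance of `f` by an average of `n+1` times
small-scale variances. Since `n` times the law of scale `1/n` lies below the Lévy measure, letting
`n` tend to infinity gives `Var f ≤ ∫ Γ(f,f) dμ` (`variance_le_integral_squaredField`). The symmetry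
`(x, x+u) ↔ (x+u, x)` yields `∫ f L f dμ = -∫ Γ(f,f) dμ` (`IsTame.integral_mul_opL`). For centred
`f` the two facts give `‖f‖² ≤ -⟨f, L f⟩`, and so `‖f‖ ≤ ‖L f‖`.

Approximate eigenvectors. The quantity `Γ(p,f)/p + f - ∫ f dμ` is the integral of `f(x+u) - f(x)`
against an explicit kernel in which the leading terms cancel. With `a = √(1+‖x‖²)`, `b =
√(1+‖x+u‖²)` and `r = ‖u‖`, the kernel is `c (a^(d+1) - b^(d+1) - r^(d+1)) / (b^(d+1) r^(d+1))`,
which the triangle inequalities bound by a multiple of `1 / (max(r,b) min(r,b)^d)`. Against a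
3/4-Hölder increment this is integrable in `u`, uniformly in `x`; together with a bound on `A f`
this gives `|L f + f - ∫ f dμ| ≤ C (B + K)` (`exists_abs_opL_add_le`), where `B` is the Hölder
constant and `K` the Taylor constant. By scaling, the truncated coordinates have `B = O(R^(1/4))`
and `K = O(1)`, whereas their norm is at least of order `R^(1/2)`, so the relative defect is
`O(R^(-1/4))`. An exponent `s` strictly between 1/2 and 1 would serve in place of 3/4: integrability
at infinity needs `s < 1`, and `R^(1-s) = o(R^(1/2))` needs `s > 1/2`.

The vanishing defect gives the limit, the approximate eigenvalue `-1`, and the lower bound on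
`functionalU`. -/

lemma image_sub_div_Ioi {a : ℝ} (ha : 0 < a) : (fun v : ℝ => v - a / v) '' Ioi 0 = univ := by
  refine eq_univ_of_forall fun y => ?_
  have h1 : 0 < y ^ 2 + 4 * a := by positivity
  have h2 : |y| < √(y ^ 2 + 4 * a) := by
    rw [← Real.sqrt_sq_eq_abs]; exact Real.sqrt_lt_sqrt (sq_nonneg _) (by linarith)
  have h3 : 0 < y + √(y ^ 2 + 4 * a) := by
    have := neg_abs_le y; linarith
  refine ⟨(y + √(y ^ 2 + 4 * a)) / 2, by simpa using h3, ?_⟩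
  have h4 := Real.sq_sqrt h1.le
  field_simp
  nlinarith

lemma injOn_sub_div_Ioi {a : ℝ} (ha : 0 < a) : InjOn (fun v : ℝ => v - a / v) (Ioi 0) := by
  intro v hv w hw h
  simp only [mem_Ioi] at hv hw
  have h1 : (v - w) * (v * w + a) = 0 := by
    have h' : v - a / v = w - a / w := h
    field_simp at h'
    linarith
  rcases mul_eq_zero.1 h1 with h | h
  · linarith
  · have := mul_pos hv hw; linarith

lemma hasDerivAt_div_self_const (a : ℝ) {v : ℝ} (hv : v ≠ 0) :
    HasDerivAt (fun v : ℝ => a / v) (-a / v ^ 2) v := by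
  have := (hasDerivAt_inv hv).const_mul a
  simpa only [div_eq_mul_inv, mul_neg, neg_mul] using this

lemma image_const_div_Ioi {a : ℝ} (ha : 0 < a) : (fun v : ℝ => a / v) '' Ioi 0 = Ioi 0 := by
  ext y
  constructor
  · rintro ⟨v, hv, rfl⟩; exact div_pos ha hv
  · intro hy
    exact ⟨a / y, div_pos ha hy, by simp only [mem_Ioi] at hy; field_simp⟩

lemma injOn_const_div_Ioi {a : ℝ} (ha : 0 < a) : InjOn (fun v : ℝ => a / v) (Ioi 0) := by
  intro v hv w hw h
  simp only [mem_Ioi] at hv hw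
  have h' : a / v = a / w := h
  field_simp at h'
  exact h'.symm

/-- Completing the square, `v² + a²/v² = (v - a/v)² + 2a`, reduces this to a Gaussian integral
through the Cauchy–Schlömilch substitution `y = v - a/v`, which maps the half-line bijectively onto
the whole line. -/
lemma integral_exp_neg_sq_add_div_sq {a : ℝ} (ha : 0 ≤ a) :
    ∫ v in Ioi (0 : ℝ), Real.exp (-(v ^ 2 + a ^ 2 / v ^ 2)) =
      √Real.pi / 2 * Real.exp (-(2 * a)) := by
  rcases ha.eq_or_lt with rfl | ha
  · have := integral_gaussian_Ioi 1
    simpa using this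
  set F : ℝ → ℝ := fun y => Real.exp (-y ^ 2) with hF
  have hFi : Integrable F := by
    simpa [hF] using integrable_exp_neg_mul_sq (b := 1) one_pos
  have hFI : ∫ y, F y = √Real.pi := by
    simpa [hF] using integral_gaussian 1
  have hd : ∀ v ∈ Ioi (0 : ℝ), HasDerivWithinAt (fun v : ℝ => v - a / v) (1 + a / v ^ 2)
      (Ioi 0) v := by
    intro v hv
    have := (hasDerivAt_id v).sub (hasDerivAt_div_self_const a (ne_of_gt hv))
    rw [neg_div, sub_neg_eq_add] at this
    exact this.hasDerivWithinAt
  have hd2 : ∀ v ∈ Ioi (0 : ℝ), HasDerivWithinAt (fun v : ℝ => a / v) (-a / v ^ 2)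
      (Ioi 0) v := fun v hv =>
    (hasDerivAt_div_self_const a (ne_of_gt hv)).hasDerivWithinAt
  have e1 := integral_image_eq_integral_abs_deriv_smul measurableSet_Ioi hd
    (injOn_sub_div_Ioi ha) F
  have i1 := integrableOn_image_iff_integrableOn_abs_deriv_smul measurableSet_Ioi hd
    (injOn_sub_div_Ioi ha) F
  rw [image_sub_div_Ioi ha] at e1 i1
  have i1' := i1.1 hFi.integrableOn
  have i2 : IntegrableOn (fun v => F (v - a / v)) (Ioi 0) := by
    refine Integrable.mono' i1' ?_ ?_
    · apply Measurable.aestronglyMeasurable; fun_prop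
    · refine (ae_restrict_iff' measurableSet_Ioi).2 (Eventually.of_forall fun v hv => ?_)
      have hp : 0 < F (v - a / v) := Real.exp_pos _
      have : 0 ≤ a / v ^ 2 := by positivity
      rw [Real.norm_of_nonneg hp.le, abs_of_nonneg (by linarith), smul_eq_mul]
      nlinarith
  have e2 := integral_image_eq_integral_abs_deriv_smul measurableSet_Ioi hd2
    (injOn_const_div_Ioi ha) (fun v => F (v - a / v))
  rw [image_const_div_Ioi ha] at e2
  -- The substitution `v ↦ a/v` changes the sign of `v - a/v`, and `F` is even. The two terms of the
  -- Jacobian `1 + a/v²` therefore contribute equally.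
  have e3 : ∫ v in Ioi (0 : ℝ), F (v - a / v) = ∫ v in Ioi (0 : ℝ), a / v ^ 2 * F (v - a / v) := by
    rw [e2]
    refine setIntegral_congr_fun measurableSet_Ioi fun v hv => ?_
    have hv' : 0 < v := hv
    have : |(-a / v ^ 2)| = a / v ^ 2 := by
      rw [neg_div, abs_neg, abs_of_nonneg (by positivity)]
    simp only [this, smul_eq_mul, hF]
    congr 3
    field_simp
    ring
  have i3 : IntegrableOn (fun v => a / v ^ 2 * F (v - a / v)) (Ioi 0) := by
    refine (i1'.sub i2).congr ((ae_restrict_iff' measurableSet_Ioi).2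
      (Eventually.of_forall fun v hv => ?_))
    have : 0 ≤ a / v ^ 2 := by positivity
    simp only [Pi.sub_apply, abs_of_nonneg (by linarith : 0 ≤ 1 + a / v ^ 2), smul_eq_mul]
    ring
  have e4 : √Real.pi = 2 * ∫ v in Ioi (0 : ℝ), F (v - a / v) := by
    rw [two_mul]
    nth_rewrite 2 [e3]
    rw [← integral_add i2 i3, ← hFI, ← setIntegral_univ, e1]
    refine setIntegral_congr_fun measurableSet_Ioi fun v hv => ?_
    have : 0 ≤ a / v ^ 2 := by positivity
    simp only [abs_of_nonneg (by linarith : 0 ≤ 1 + a / v ^ 2), smul_eq_mul]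
    ring
  rw [e4, mul_div_cancel_left₀ _ two_ne_zero, ← integral_mul_const]
  refine setIntegral_congr_fun measurableSet_Ioi fun v hv => ?_
  have hv' : 0 < v := hv
  simp only [hF, ← Real.exp_add]
  congr 1
  field_simp
  ring

/-- The substitution `w = v²` turns this into the preceding integral with `a = l/2`. -/
lemma integral_rpow_neg_half_mul_exp {l : ℝ} (hl : 0 ≤ l) :
    ∫ w in Ioi (0 : ℝ), w ^ (-(1 / 2) : ℝ) * Real.exp (-w - l ^ 2 / (4 * w)) =
      √Real.pi * Real.exp (-l) := by
  have := integral_comp_rpow_Ioi_of_pos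
    (g := fun w : ℝ => w ^ (-(1 / 2) : ℝ) * Real.exp (-w - l ^ 2 / (4 * w))) (p := 2) two_pos
  rw [← this]
  have h2 := integral_exp_neg_sq_add_div_sq (a := l / 2) (by positivity)
  have : √Real.pi * Real.exp (-l) = 2 * (√Real.pi / 2 * Real.exp (-(2 * (l / 2)))) := by
    rw [show 2 * (l / 2) = l by ring]; ring
  rw [this, ← h2, ← integral_const_mul]
  refine setIntegral_congr_fun measurableSet_Ioi fun v hv => ?_
  have hv' : 0 < v := hv
  have e1 : (v ^ (2 : ℝ)) ^ (-(1 / 2) : ℝ) = v⁻¹ := by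
    rw [← Real.rpow_mul hv'.le]; norm_num [Real.rpow_neg_one]
  have e2 : v ^ ((2 : ℝ) - 1) = v := by norm_num
  have e3 : v ^ (2 : ℝ) = v ^ 2 := by norm_cast
  simp only [smul_eq_mul, e1, e2]
  rw [e3, show -v ^ 2 - l ^ 2 / (4 * v ^ 2) = -(v ^ 2 + (l / 2) ^ 2 / v ^ 2) by
    field_simp; ring]
  field_simp

lemma cauchyConst_pos (d : ℕ) : 0 < cauchyConst d := by
  unfold cauchyConst
  have : 0 < Real.Gamma (((d : ℝ) + 1) / 2) := Real.Gamma_pos_of_pos (by positivity)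
  positivity

lemma cauchyDensity_pos (d : ℕ) (x : EuclideanSpace ℝ (Fin d)) : 0 < cauchyDensity d x := by
  unfold cauchyDensity
  have := cauchyConst_pos d
  positivity

lemma continuous_cauchyDensity (d : ℕ) : Continuous (cauchyDensity d) := by
  unfold cauchyDensity
  refine continuous_const.div ?_ fun x => by positivity
  exact Continuous.rpow_const (by fun_prop) fun x => Or.inl (by positivity)

lemma measurable_cauchyDensity (d : ℕ) : Measurable (cauchyDensity d) :=
  (continuous_cauchyDensity d).measurable

lemma integral_cauchyMeasure {F : Type*} [NormedAddCommGroup F] [NormedSpace ℝ F] (d : ℕ)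
    (f : EuclideanSpace ℝ (Fin d) → F) :
    ∫ x, f x ∂(cauchyMeasure d) = ∫ x, cauchyDensity d x • f x := by
  unfold cauchyMeasure
  rw [integral_withDensity_eq_integral_toReal_smul
    (measurable_cauchyDensity d).ennreal_ofReal (by simp)]
  simp [ENNReal.toReal_ofReal (cauchyDensity_pos d _).le]

/-- The Gamma integral with rate `1 + ‖x‖²` exhibits the Cauchy law as a mixture of centred
Gaussians. -/
lemma cauchyDensity_eq_integral (d : ℕ) (x : EuclideanSpace ℝ (Fin d)) :
    cauchyDensity d x = ∫ w in Ioi (0 : ℝ),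
      Real.pi ^ (-(((d : ℝ) + 1) / 2)) * (w ^ (((d : ℝ) - 1) / 2) *
        Real.exp (-((1 + ‖x‖ ^ 2) * w))) := by
  have h := Real.integral_rpow_mul_exp_neg_mul_Ioi (a := ((d : ℝ) + 1) / 2)
    (r := 1 + ‖x‖ ^ 2) (by positivity) (by positivity)
  rw [integral_const_mul, show ((d : ℝ) - 1) / 2 = ((d : ℝ) + 1) / 2 - 1 by ring, h,
    cauchyDensity, cauchyConst, one_div, Real.inv_rpow (by positivity),
    Real.rpow_neg Real.pi_pos.le]
  field_simp

/-- Integrating in `x` produces `(π/w)^(d/2)`, which leaves `w^(-1/2) exp (-w)`, the integrand of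
`Γ(1/2)`. -/
lemma integrable_gaussian_mixture (d : ℕ) :
    Integrable (fun z : EuclideanSpace ℝ (Fin d) × ℝ =>
      z.2 ^ (((d : ℝ) - 1) / 2) * Real.exp (-((1 + ‖z.1‖ ^ 2) * z.2)))
      (volume.prod (volume.restrict (Ioi 0))) := by
  have hm : AEStronglyMeasurable (fun z : EuclideanSpace ℝ (Fin d) × ℝ =>
      z.2 ^ (((d : ℝ) - 1) / 2) * Real.exp (-((1 + ‖z.1‖ ^ 2) * z.2)))
      (volume.prod (volume.restrict (Ioi 0))) := by
    apply Measurable.aestronglyMeasurable; fun_prop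
  have he : ∀ (w : ℝ) (x : EuclideanSpace ℝ (Fin d)), Real.exp (-((1 + ‖x‖ ^ 2) * w)) =
      Real.exp (-w) * Real.exp (-w * ‖x‖ ^ 2) := by
    intro w x; rw [← Real.exp_add]; congr 1; ring
  have hn : ∀ w ∈ Ioi (0 : ℝ), ∀ x : EuclideanSpace ℝ (Fin d),
      ‖w ^ (((d : ℝ) - 1) / 2) * Real.exp (-((1 + ‖x‖ ^ 2) * w))‖ =
      w ^ (((d : ℝ) - 1) / 2) * Real.exp (-((1 + ‖x‖ ^ 2) * w)) := by
    intro w hw x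
    have hw' : 0 < w := hw
    exact Real.norm_of_nonneg (by positivity)
  refine (integrable_prod_iff' hm).2 ⟨?_, ?_⟩
  · refine (ae_restrict_iff' measurableSet_Ioi).2 (Eventually.of_forall fun w hw => ?_)
    simp only [he]
    refine ((Integrable.const_mul ?_ _).const_mul _)
    have := (GaussianFourier.integrable_cexp_neg_mul_sq_norm_add (b := (w : ℂ))
      (by simpa using hw) 0 (0 : EuclideanSpace ℝ (Fin d))).re
    refine this.congr (Eventually.of_forall fun x => ?_)
    simp [← Complex.ofReal_pow, ← Complex.ofReal_mul, ← Complex.ofReal_neg, Complex.exp_ofReal_re]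
  · have hg : IntegrableOn (fun w : ℝ => Real.pi ^ ((d : ℝ) / 2) *
        (Real.exp (-w) * w ^ ((1 / 2 : ℝ) - 1))) (Ioi 0) :=
      (Real.GammaIntegral_convergent (by norm_num)).const_mul _
    refine hg.congr ((ae_restrict_iff' measurableSet_Ioi).2 (Eventually.of_forall fun w hw => ?_))
    have hw' : 0 < w := hw
    simp only [hn w hw]
    simp only [he, integral_const_mul]
    rw [GaussianFourier.integral_rexp_neg_mul_sq_norm hw', finrank_euclideanSpace_fin,
      Real.div_rpow Real.pi_pos.le hw'.le,
      show (1 / 2 : ℝ) - 1 = ((d : ℝ) - 1) / 2 - (d : ℝ) / 2 by ring, Real.rpow_sub hw']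
    field_simp

/-- Fubini in the Gaussian mixture: each Gaussian contributes `exp (-‖ξ‖²/(4w))`, and the remaining
integral in `w` is `integral_rpow_neg_half_mul_exp` with `l = ‖ξ‖`. -/
lemma charFun_cauchyMeasure (d : ℕ) (ξ : EuclideanSpace ℝ (Fin d)) :
    charFun (cauchyMeasure d) ξ = Complex.exp (-‖ξ‖) := by
  rw [charFun_apply, integral_cauchyMeasure]
  set G : EuclideanSpace ℝ (Fin d) → ℝ → ℂ := fun x w =>
    ((Real.pi ^ (-(((d : ℝ) + 1) / 2)) * (w ^ (((d : ℝ) - 1) / 2) *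
        Real.exp (-((1 + ‖x‖ ^ 2) * w))) : ℝ) : ℂ) * Complex.exp (inner ℝ x ξ * Complex.I) with hG
  have h1 : ∀ x : EuclideanSpace ℝ (Fin d),
      cauchyDensity d x • Complex.exp (inner ℝ x ξ * Complex.I) = ∫ w in Ioi (0 : ℝ), G x w := by
    intro x
    rw [cauchyDensity_eq_integral, Complex.real_smul, ← integral_complex_ofReal,
      ← integral_mul_const]
  simp only [h1]
  have hi : Integrable (Function.uncurry G) (volume.prod (volume.restrict (Ioi 0))) := by
    have := (((integrable_gaussian_mixture d).const_mul
      (Real.pi ^ (-(((d : ℝ) + 1) / 2)))).ofReal (𝕜 := ℂ)).bdd_mul (c := 1)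
      (f := fun z : EuclideanSpace ℝ (Fin d) × ℝ => Complex.exp (inner ℝ z.1 ξ * Complex.I))
      (by apply Continuous.aestronglyMeasurable; fun_prop)
      (Eventually.of_forall fun z => by rw [Complex.norm_exp_ofReal_mul_I])
    refine this.congr (Eventually.of_forall fun z => ?_)
    simp [hG, Function.uncurry, mul_comm]
  rw [integral_integral_swap hi]
  have h2 : ∀ w ∈ Ioi (0 : ℝ), ∫ x, G x w =
      (((√Real.pi)⁻¹ * (w ^ (-(1 / 2) : ℝ) * Real.exp (-w - ‖ξ‖ ^ 2 / (4 * w))) : ℝ) : ℂ) := by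
    intro w hw
    have hw' : 0 < w := hw
    have h3 : ∀ x, G x w = ((Real.pi ^ (-(((d : ℝ) + 1) / 2)) * w ^ (((d : ℝ) - 1) / 2) *
        Real.exp (-w) : ℝ) : ℂ) *
        Complex.exp (-(w : ℂ) * ‖x‖ ^ 2 + Complex.I * (inner ℝ ξ x : ℝ)) := by
      intro x
      simp only [hG]
      rw [show (-((1 + ‖x‖ ^ 2) * w)) = -w + -w * ‖x‖ ^ 2 by ring, Real.exp_add, Complex.exp_add,
        real_inner_comm ξ x]
      push_cast
      ring_nf
    simp only [h3]
    rw [integral_const_mul, GaussianFourier.integral_cexp_neg_mul_sq_norm_add (by simpa using hw'),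
      finrank_euclideanSpace_fin]
    have h4 : ((Real.pi : ℂ) / (w : ℂ)) ^ ((d : ℂ) / 2) = (((Real.pi / w) ^ ((d : ℝ) / 2) : ℝ) : ℂ) := by
      rw [Complex.ofReal_cpow (by positivity)]; push_cast; rfl
    have h5 : Complex.exp (Complex.I ^ 2 * (‖ξ‖ : ℂ) ^ 2 / (4 * (w : ℂ))) =
        ((Real.exp (-(‖ξ‖ ^ 2 / (4 * w))) : ℝ) : ℂ) := by
      push_cast; rw [Complex.I_sq]; congr 1; ring
    rw [h4, h5, ← Complex.ofReal_mul, ← Complex.ofReal_mul, Complex.ofReal_inj]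
    rw [sub_eq_add_neg (-w), Real.exp_add, Real.div_rpow Real.pi_pos.le hw'.le, Real.sqrt_eq_rpow,
      show (-(((d : ℝ) + 1) / 2)) = -((d : ℝ) / 2) - 1 / 2 by ring,
      show (((d : ℝ) - 1) / 2) = (d : ℝ) / 2 + (-(1 / 2)) by ring,
      Real.rpow_add hw', Real.rpow_sub Real.pi_pos, Real.rpow_neg Real.pi_pos.le]
    have := Real.rpow_pos_of_pos Real.pi_pos ((d : ℝ) / 2)
    have := Real.rpow_pos_of_pos hw' ((d : ℝ) / 2)
    field_simp
  rw [setIntegral_congr_fun measurableSet_Ioi h2, integral_complex_ofReal, integral_const_mul,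
    integral_rpow_neg_half_mul_exp (norm_nonneg ξ)]
  rw [← mul_assoc, inv_mul_cancel₀ (by positivity), one_mul]
  push_cast
  rfl

lemma integrable_cauchyDensity (d : ℕ) : Integrable (cauchyDensity d) := by
  have := (((integrable_gaussian_mixture d).const_mul
    (Real.pi ^ (-(((d : ℝ) + 1) / 2))))).integral_prod_left
  refine this.congr (Eventually.of_forall fun x => ?_)
  simp only [cauchyDensity_eq_integral d x]

instance isFiniteMeasure_cauchyMeasure (d : ℕ) : IsFiniteMeasure (cauchyMeasure d) :=
  isFiniteMeasure_withDensity_ofReal (integrable_cauchyDensity d).hasFiniteIntegral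

/-- The total mass is the value of the characteristic function at the origin. -/
instance isProbabilityMeasure_cauchyMeasure (d : ℕ) : IsProbabilityMeasure (cauchyMeasure d) := by
  have h := charFun_cauchyMeasure d 0
  rw [charFun_zero] at h
  simp only [norm_zero, Complex.ofReal_zero, neg_zero, Complex.exp_zero] at h
  refine ⟨?_⟩
  have h' : (cauchyMeasure d).real univ = 1 := by exact_mod_cast h
  simpa [Measure.real, ENNReal.toReal_eq_one_iff] using h'

/-- The Cauchy laws of different scales form a convolution semigroup. -/
lemma map_smul_conv_map_smul (d : ℕ) {s t : ℝ} (hs : 0 ≤ s) (ht : 0 ≤ t) :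
    (cauchyMeasure d).map (s • ·) ∗ (cauchyMeasure d).map (t • ·) =
      (cauchyMeasure d).map ((s + t) • ·) := by
  have : ∀ r : ℝ, IsProbabilityMeasure ((cauchyMeasure d).map (r • ·)) := fun r =>
    Measure.isProbabilityMeasure_map (by fun_prop)
  refine Measure.ext_of_charFun ?_
  ext ξ
  rw [charFun_conv]
  simp only [charFun_map_smul, charFun_cauchyMeasure, norm_smul, Real.norm_of_nonneg hs,
    Real.norm_of_nonneg ht, Real.norm_of_nonneg (add_nonneg hs ht), ← Complex.exp_add]
  push_cast
  ring_nf

open scoped BoundedContinuousFunction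

/-! ### Averages over translations and the tensorized variance inequality -/

section TranslateAverage

variable {E : Type*} [NormedAddCommGroup E] [MeasurableSpace E] [BorelSpace E]

lemma integrable_comp_add (κ : Measure E) [IsFiniteMeasure κ] (f : E →ᵇ ℝ) (x : E) :
    Integrable (fun u => f (x + u)) κ := by
  refine Integrable.of_bound (C := ‖f‖) ?_ (Eventually.of_forall fun u => f.norm_coe_le_norm _)
  exact (f.continuous.comp (by fun_prop)).aestronglyMeasurable

/-- The operator `f ↦ (x ↦ ∫ f (x + u) κ(du))`. -/
def translateAverage (κ : Measure E) [IsProbabilityMeasure κ] : (E →ᵇ ℝ) →ₗ[ℝ] (E →ᵇ ℝ) where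
  toFun f := BoundedContinuousFunction.ofNormedAddCommGroup (fun x => ∫ u, f (x + u) ∂κ)
    (continuous_of_dominated (bound := fun _ => ‖f‖)
      (fun x => (integrable_comp_add κ f x).aestronglyMeasurable)
      (fun x => Eventually.of_forall fun u => f.norm_coe_le_norm _)
      (integrable_const _)
      (Eventually.of_forall fun u => f.continuous.comp (by fun_prop))) ‖f‖
    (fun x => by
      have := norm_integral_le_of_norm_le_const (μ := κ) (f := fun u => f (x + u)) (C := ‖f‖)
        (Eventually.of_forall fun u => f.norm_coe_le_norm _)
      simpa using this)
  map_add' f g := by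
    ext x
    exact integral_add (integrable_comp_add κ f x) (integrable_comp_add κ g x)
  map_smul' c f := by
    ext x
    exact integral_const_mul c _

lemma translateAverage_apply (κ : Measure E) [IsProbabilityMeasure κ] (f : E →ᵇ ℝ) (x : E) :
    translateAverage κ f x = ∫ u, f (x + u) ∂κ := rfl

lemma monotone_translateAverage (κ : Measure E) [IsProbabilityMeasure κ] :
    Monotone (translateAverage κ) := by
  intro f g h x
  exact integral_mono (integrable_comp_add κ f x) (integrable_comp_add κ g x) fun u => h _

/-- The variance of `f (x + ·)` under `κ`, as a function of `x`. -/
def translateVariance (κ : Measure E) [IsProbabilityMeasure κ] (f : E →ᵇ ℝ) : E →ᵇ ℝ :=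
  translateAverage κ (f ^ 2) - (translateAverage κ f) ^ 2

lemma integral_sub_const_sq {Ω : Type*} [MeasurableSpace Ω] (κ : Measure Ω)
    [IsProbabilityMeasure κ] {f : Ω → ℝ} (hf : Integrable f κ)
    (hf2 : Integrable (fun u => f u ^ 2) κ) (c : ℝ) :
    ∫ u, (f u - c) ^ 2 ∂κ = ∫ u, f u ^ 2 ∂κ - (∫ u, f u ∂κ) ^ 2 + (∫ u, f u ∂κ - c) ^ 2 := by
  have h : ∀ u, (f u - c) ^ 2 = f u ^ 2 - 2 * c * f u + c ^ 2 := fun u => by ring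
  have h1 : Integrable (fun u => 2 * c * f u) κ := hf.const_mul _
  have h2 : Integrable (fun u => f u ^ 2 - 2 * c * f u) κ := hf2.sub h1
  simp only [h]
  rw [integral_add h2 (integrable_const _), integral_sub hf2 h1, integral_const_mul]
  simp
  ring

lemma sq_integral_le_integral_sq {Ω : Type*} [MeasurableSpace Ω] (κ : Measure Ω)
    [IsProbabilityMeasure κ] {f : Ω → ℝ} (hf : Integrable f κ)
    (hf2 : Integrable (fun u => f u ^ 2) κ) :
    (∫ u, f u ∂κ) ^ 2 ≤ ∫ u, f u ^ 2 ∂κ := by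
  have h := integral_sub_const_sq κ hf hf2 (∫ u, f u ∂κ)
  have h0 : 0 ≤ ∫ u, (f u - ∫ u, f u ∂κ) ^ 2 ∂κ := integral_nonneg fun u => sq_nonneg _
  rw [sub_self] at h
  linarith

/-- The bias–variance decomposition. With `c = f x` it bounds the variance by the mean squared
increment from `x`. -/
lemma translateVariance_add_sq (κ : Measure E) [IsProbabilityMeasure κ] (f : E →ᵇ ℝ) (x : E)
    (c : ℝ) : translateVariance κ f x + (translateAverage κ f x - c) ^ 2 =
      ∫ u, (f (x + u) - c) ^ 2 ∂κ := by
  rw [integral_sub_const_sq κ (integrable_comp_add κ f x) (integrable_comp_add κ (f ^ 2) x)]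
  rfl

lemma translateVariance_eq (κ : Measure E) [IsProbabilityMeasure κ] (f : E →ᵇ ℝ) (x : E) :
    translateVariance κ f x = ∫ u, (f (x + u) - translateAverage κ f x) ^ 2 ∂κ := by
  rw [← translateVariance_add_sq κ f x (translateAverage κ f x)]; simp

/-- Averaging contracts the variance by Jensen. The deviation of `P f` at `x + u` from its mean is
itself an average over `v` of `f(x+u+v) - P f(x+v)`; squaring inside that average and exchanging the
integrals gives the claim. -/
lemma translateVariance_translateAverage_le [SecondCountableTopology E] (κ : Measure E) [IsProbabilityMeasure κ]
    (f : E →ᵇ ℝ) :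
    translateVariance κ (translateAverage κ f) ≤ translateAverage κ (translateVariance κ f) := by
  intro x
  set a := translateAverage κ f with ha
  have hG : Integrable (fun z : E × E => (f (x + z.1 + z.2) - a (x + z.2)) ^ 2) (κ.prod κ) := by
    refine Integrable.of_bound (C := (‖f‖ + ‖a‖) ^ 2) ?_ (Eventually.of_forall fun z => ?_)
    · apply Continuous.aestronglyMeasurable; fun_prop
    · rw [norm_pow]
      have := norm_sub_le (f (x + z.1 + z.2)) (a (x + z.2))
      have h1 := f.norm_coe_le_norm (x + z.1 + z.2)
      have h2 := a.norm_coe_le_norm (x + z.2)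
      gcongr; linarith
  have hc : translateAverage κ a x = ∫ v, a (x + v) ∂κ := rfl
  change translateVariance κ a x ≤ translateAverage κ (translateVariance κ f) x
  rw [translateVariance_eq κ a x]
  calc ∫ u, (a (x + u) - translateAverage κ a x) ^ 2 ∂κ
      ≤ ∫ u, ∫ v, (f (x + u + v) - a (x + v)) ^ 2 ∂κ ∂κ := by
        refine integral_mono ?_ hG.integral_prod_left fun u => ?_
        · refine Integrable.of_bound (C := (‖a‖ + ‖translateAverage κ a x‖) ^ 2) ?_
            (Eventually.of_forall fun z => ?_)
          · apply Continuous.aestronglyMeasurable; fun_prop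
          · rw [norm_pow]
            have := norm_sub_le (a (x + z)) (translateAverage κ a x)
            have h2 := a.norm_coe_le_norm (x + z)
            gcongr; linarith
        · have e : a (x + u) - translateAverage κ a x =
              ∫ v, (f (x + u + v) - a (x + v)) ∂κ := by
            rw [integral_sub (integrable_comp_add κ f _) (integrable_comp_add κ a _)]; rfl
          simp only [e]
          refine sq_integral_le_integral_sq κ
            ((integrable_comp_add κ f _).sub (integrable_comp_add κ a _)) ?_
          refine Integrable.of_bound (C := (‖f‖ + ‖a‖) ^ 2) ?_ (Eventually.of_forall fun z => ?_)
          · apply Continuous.aestronglyMeasurable; fun_prop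
          · rw [norm_pow]
            have := norm_sub_le (f (x + u + z)) (a (x + z))
            have h1 := f.norm_coe_le_norm (x + u + z)
            have h2 := a.norm_coe_le_norm (x + z)
            gcongr; linarith
    _ = ∫ v, ∫ u, (f (x + u + v) - a (x + v)) ^ 2 ∂κ ∂κ := integral_integral_swap hG
    _ = ∫ v, translateVariance κ f (x + v) ∂κ := by
        refine integral_congr_ae (Eventually.of_forall fun v => ?_)
        simp only [translateVariance_eq κ f (x + v), add_right_comm x v]
        rfl

/-- Tensorization of the variance, written for the iterates of one averaging operator `P`. The law
of total variance peels off one factor, `P^(n+2) (f²) = P^(n+1) (Var f) + P^(n+1) ((P f)²)`. The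
induction hypothesis for `P f`, combined with the contraction of the variance, gives `n+1` more
copies of the first term. -/
lemma translateAverage_iterate_variance_le [SecondCountableTopology E] (κ : Measure E) [IsProbabilityMeasure κ] (n : ℕ) :
    ∀ f : E →ᵇ ℝ, (translateAverage κ ^ (n + 1)) (f ^ 2) - ((translateAverage κ ^ (n + 1)) f) ^ 2 ≤
      ((n : ℝ) + 1) • (translateAverage κ ^ n) (translateVariance κ f) := by
  have hmono : ∀ k : ℕ, Monotone (translateAverage κ ^ k) := by
    intro k
    rw [Module.End.coe_pow]
    exact (monotone_translateAverage κ).iterate k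
  have hs : ∀ (k : ℕ) (f : E →ᵇ ℝ), (translateAverage κ ^ (k + 1)) f =
      (translateAverage κ ^ k) (translateAverage κ f) := by
    intro k f; rw [pow_succ]; rfl
  induction n with
  | zero =>
    intro f
    simp [translateVariance]
  | succ n ih =>
    intro f
    have h1 := ih (translateAverage κ f)
    have h2 := hmono n (translateVariance_translateAverage_le κ f)
    rw [← hs] at h2
    have e : (translateAverage κ ^ (n + 1 + 1)) (f ^ 2) =
        (translateAverage κ ^ (n + 1)) (translateVariance κ f) +
        (translateAverage κ ^ (n + 1)) ((translateAverage κ f) ^ 2) := by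
      rw [hs, ← map_add, translateVariance, sub_add_cancel]
    intro x
    have h1x : (translateAverage κ ^ (n + 1)) ((translateAverage κ f) ^ 2) x -
        ((translateAverage κ ^ (n + 1)) (translateAverage κ f) x) ^ 2 ≤ ((n : ℝ) + 1) *
        (translateAverage κ ^ n) (translateVariance κ (translateAverage κ f)) x := h1 x
    have h2x : (translateAverage κ ^ n) (translateVariance κ (translateAverage κ f)) x ≤
        (translateAverage κ ^ (n + 1)) (translateVariance κ f) x := h2 x
    rw [e, hs (n + 1) f]
    change (translateAverage κ ^ (n + 1)) (translateVariance κ f) x +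
        (translateAverage κ ^ (n + 1)) ((translateAverage κ f) ^ 2) x -
        ((translateAverage κ ^ (n + 1)) (translateAverage κ f) x) ^ 2 ≤ (((n + 1 : ℕ) : ℝ) + 1) *
        (translateAverage κ ^ (n + 1)) (translateVariance κ f) x
    push_cast
    have hn : (0 : ℝ) ≤ n + 1 := by positivity
    nlinarith [mul_le_mul_of_nonneg_left h2x hn]

end TranslateAverage

/-- The Cauchy law of scale `t`. -/
def scaledCauchy (d : ℕ) (t : ℝ) : Measure (EuclideanSpace ℝ (Fin d)) :=
  (cauchyMeasure d).map (t • ·)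

instance isProbabilityMeasure_scaledCauchy (d : ℕ) (t : ℝ) :
    IsProbabilityMeasure (scaledCauchy d t) :=
  Measure.isProbabilityMeasure_map (by fun_prop)

lemma translateAverage_scaledCauchy_apply (d : ℕ) (t : ℝ)
    (f : EuclideanSpace ℝ (Fin d) →ᵇ ℝ) (x : EuclideanSpace ℝ (Fin d)) :
    translateAverage (scaledCauchy d t) f x = ∫ u, f (x + t • u) ∂(cauchyMeasure d) := by
  rw [translateAverage_apply, scaledCauchy, integral_map (by fun_prop)]
  exact (f.continuous.comp (by fun_prop)).aestronglyMeasurable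

lemma translateAverage_scaledCauchy_comp (d : ℕ) {s t : ℝ} (hs : 0 ≤ s) (ht : 0 ≤ t)
    (f : EuclideanSpace ℝ (Fin d) →ᵇ ℝ) :
    translateAverage (scaledCauchy d s) (translateAverage (scaledCauchy d t) f) =
      translateAverage (scaledCauchy d (s + t)) f := by
  ext x
  have hc := map_smul_conv_map_smul d hs ht
  change scaledCauchy d s ∗ scaledCauchy d t = scaledCauchy d (s + t) at hc
  rw [translateAverage_apply _ f, ← hc, integral_conv]
  · simp only [translateAverage_apply, add_assoc]
  · rw [hc]; exact integrable_comp_add _ f x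

lemma translateAverage_scaledCauchy_pow (d : ℕ) {t : ℝ} (ht : 0 ≤ t) (n : ℕ)
    (f : EuclideanSpace ℝ (Fin d) →ᵇ ℝ) :
    (translateAverage (scaledCauchy d t) ^ n) f = translateAverage (scaledCauchy d (n * t)) f := by
  induction n with
  | zero =>
    ext x
    rw [translateAverage_scaledCauchy_apply]
    simp
  | succ n ih =>
    rw [pow_succ', Module.End.mul_apply, ih,
      translateAverage_scaledCauchy_comp d ht (by positivity)]
    congr 3
    push_cast; ring

/-! ### The Lévy measure -/

lemma measurable_levyDensity (d : ℕ) :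
    Measurable fun u : EuclideanSpace ℝ (Fin d) => cauchyConst d / ‖u‖ ^ (d + 1) := by
  fun_prop

lemma levyDensity_nonneg (d : ℕ) (u : EuclideanSpace ℝ (Fin d)) :
    0 ≤ cauchyConst d / ‖u‖ ^ (d + 1) := by
  have := cauchyConst_pos d
  positivity

instance sigmaFinite_levyMeasure (d : ℕ) : SigmaFinite (levyMeasure d) :=
  SigmaFinite.withDensity_ofReal _

lemma integral_levyMeasure (d : ℕ) (f : EuclideanSpace ℝ (Fin d) → ℝ) :
    ∫ u, f u ∂(levyMeasure d) = ∫ u, cauchyConst d / ‖u‖ ^ (d + 1) * f u := by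
  unfold levyMeasure
  rw [integral_withDensity_eq_integral_toReal_smul
    (measurable_levyDensity d).ennreal_ofReal (by simp)]
  simp [ENNReal.toReal_ofReal (levyDensity_nonneg d _)]

lemma integrable_levyMeasure_iff (d : ℕ) {f : EuclideanSpace ℝ (Fin d) → ℝ} :
    Integrable f (levyMeasure d) ↔
      Integrable fun u => cauchyConst d / ‖u‖ ^ (d + 1) * f u := by
  unfold levyMeasure
  rw [integrable_withDensity_iff_integrable_smul'
    (measurable_levyDensity d).ennreal_ofReal (by simp)]
  simp [ENNReal.toReal_ofReal (levyDensity_nonneg d _)]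

/-- A radial weight, integrable for the Lévy measure, which controls the integrands of
`opA` and `squaredField`. -/
def levyWeight {d : ℕ} (u : EuclideanSpace ℝ (Fin d)) : ℝ := min (‖u‖ ^ 2) (‖u‖ ^ (3 / 4 : ℝ))

lemma levyWeight_nonneg {d : ℕ} (u : EuclideanSpace ℝ (Fin d)) : 0 ≤ levyWeight u := by
  unfold levyWeight; positivity

/-- A quadratic bound near the origin and a plain bound far away suffice, since `‖u‖² ≤ ‖u‖^(3/4)`
inside the unit ball and `1 ≤ ‖u‖^(3/4)` outside. -/
lemma le_mul_levyWeight {d : ℕ} {u : EuclideanSpace ℝ (Fin d)} {t C : ℝ} (hC : 0 ≤ C)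
    (h1 : t ≤ C * ‖u‖ ^ 2) (h2 : t ≤ C) : t ≤ C * levyWeight u := by
  unfold levyWeight
  rw [mul_min_of_nonneg _ _ hC]
  refine le_min h1 ?_
  rcases le_total ‖u‖ 1 with h | h
  · refine h1.trans (mul_le_mul_of_nonneg_left ?_ hC)
    rw [← Real.rpow_natCast]
    rcases (norm_nonneg u).eq_or_lt with h0 | h0
    · rw [← h0]; norm_num
    · exact Real.rpow_le_rpow_of_exponent_ge h0 h (by norm_num)
  · exact h2.trans (le_mul_of_one_le_right hC (Real.one_le_rpow h (by norm_num)))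

/-- Polar coordinates: the factor `y^(d-1)` is the radial Jacobian, and the exponent conditions are
those for powers at zero and at infinity. -/
lemma integrable_radial {d : ℕ} (hd : 1 ≤ d) {φ : ℝ → ℝ} {C a b : ℝ} (ha : -1 < a) (hb : b < -1)
    (h1 : ∀ y ∈ Ioo (0 : ℝ) 1, y ^ (d - 1) * φ y = C * y ^ a)
    (h2 : ∀ y ∈ Ioi (1 : ℝ), y ^ (d - 1) * φ y = C * y ^ b) :
    Integrable fun u : EuclideanSpace ℝ (Fin d) => φ ‖u‖ := by
  have : Nonempty (Fin d) := ⟨⟨0, hd⟩⟩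
  rw [integrable_fun_norm_addHaar, finrank_euclideanSpace_fin]
  have e : Ioi (0 : ℝ) = (Ioo 0 1 ∪ {1}) ∪ Ioi 1 := by
    ext y; simp only [mem_Ioi, mem_union, mem_Ioo, mem_singleton_iff]
    constructor
    · intro h; rcases lt_trichotomy y 1 with h' | h' | h'
      · exact Or.inl (Or.inl ⟨h, h'⟩)
      · exact Or.inl (Or.inr h')
      · exact Or.inr h'
    · rintro ((h | h) | h)
      · exact h.1
      · rw [h]; exact one_pos
      · linarith
  rw [e]
  refine (IntegrableOn.union ?_ (integrableOn_singleton (by simp) (by simp))).union ?_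
  · refine IntegrableOn.congr_fun (f := fun y => C * y ^ a) ?_ (fun y hy => (h1 y hy).symm)
      measurableSet_Ioo
    exact ((intervalIntegral.integrableOn_Ioo_rpow_iff one_pos).2 ha).const_mul _
  · refine IntegrableOn.congr_fun (f := fun y => C * y ^ b) ?_ (fun y hy => (h2 y hy).symm)
      measurableSet_Ioi
    exact (integrableOn_Ioi_rpow_of_lt hb one_pos).const_mul _

lemma integrable_levyWeight {d : ℕ} (hd : 1 ≤ d) :
    Integrable (levyWeight (d := d)) (levyMeasure d) := by
  rw [integrable_levyMeasure_iff]
  refine integrable_radial hd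
    (φ := fun y => cauchyConst d / y ^ (d + 1) * min (y ^ 2) (y ^ (3 / 4 : ℝ)))
    (C := cauchyConst d) (a := 0) (b := -(5 / 4)) (by norm_num) (by norm_num) ?_ ?_
  · rintro y ⟨hy0, hy1⟩
    have : y ^ 2 ≤ y ^ (3 / 4 : ℝ) := by
      rw [← Real.rpow_natCast]
      exact Real.rpow_le_rpow_of_exponent_ge hy0 hy1.le (by norm_num)
    simp only [min_eq_left this]
    rw [show d + 1 = (d - 1) + 2 by omega, pow_add]
    field_simp
    simp
  · intro y hy
    have hy1 : 1 < y := hy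
    have hy0 : 0 < y := one_pos.trans hy1
    have : y ^ (3 / 4 : ℝ) ≤ y ^ 2 := by
      rw [← Real.rpow_natCast]
      exact Real.rpow_le_rpow_of_exponent_le hy1.le (by norm_num)
    simp only [min_eq_right this]
    rw [show d + 1 = (d - 1) + 2 by omega, pow_add,
      show (-(5 / 4) : ℝ) = 3 / 4 - 2 by norm_num, Real.rpow_sub hy0]
    norm_cast
    field_simp

lemma ae_ne_zero_euclidean {d : ℕ} (hd : 1 ≤ d) :
    ∀ᵐ u : EuclideanSpace ℝ (Fin d), u ≠ 0 := by
  have : Nonempty (Fin d) := ⟨⟨0, hd⟩⟩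
  have := Measure.ae_ne (volume : Measure (EuclideanSpace ℝ (Fin d))) 0
  exact this

lemma le_one_add_sq_rpow (d : ℕ) {r : ℝ} (hr : 0 ≤ r) :
    r ^ (d + 1) ≤ (1 + r ^ 2) ^ (((d : ℝ) + 1) / 2) := by
  have : r ^ (d + 1) = (r ^ 2) ^ (((d : ℝ) + 1) / 2) := by
    rw [← Real.rpow_natCast r 2, ← Real.rpow_mul hr, ← Real.rpow_natCast]
    congr 1; push_cast; ring
  rw [this]
  gcongr; linarith

/-- `n` times the law of scale `1/n` is bounded by the Lévy measure. -/
lemma mul_integral_scaled_le {d : ℕ} (hd : 1 ≤ d) {n : ℝ} (hn : 0 < n)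
    {φ : EuclideanSpace ℝ (Fin d) → ℝ} (h0 : ∀ u, 0 ≤ φ u)
    (hφ : Integrable φ (levyMeasure d)) :
    n * ∫ u, φ (n⁻¹ • u) ∂(cauchyMeasure d) ≤ ∫ u, φ u ∂(levyMeasure d) := by
  rw [integral_cauchyMeasure, integral_levyMeasure]
  have e := Measure.integral_comp_smul (volume : Measure (EuclideanSpace ℝ (Fin d)))
    (fun v => cauchyDensity d (n • v) • φ v) n⁻¹
  simp only [smul_inv_smul₀ hn.ne', finrank_euclideanSpace_fin] at e
  rw [e, inv_pow, inv_inv, abs_of_pos (by positivity), smul_eq_mul, ← mul_assoc,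
    ← integral_const_mul]
  refine integral_mono_of_nonneg (Eventually.of_forall fun u => ?_)
    ((integrable_levyMeasure_iff d).1 hφ) ?_
  · have := cauchyDensity_pos d (n • u)
    have := h0 u
    simp only [Pi.zero_apply, smul_eq_mul]; positivity
  · filter_upwards [ae_ne_zero_euclidean hd] with u hu
    have hu' : 0 < ‖u‖ := norm_pos_iff.2 hu
    rw [smul_eq_mul, ← mul_assoc]
    refine mul_le_mul_of_nonneg_right ?_ (h0 u)
    have h1 := le_one_add_sq_rpow d (norm_nonneg (n • u))
    rw [norm_smul, Real.norm_of_nonneg hn.le] at h1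
    have hc := cauchyConst_pos d
    -- The left side is the density of `n` times the law of scale `1/n`; dropping the `1` in `1 + ‖n
    -- u‖²` gives exactly the Lévy density.
    calc n * n ^ d * cauchyDensity d (n • u)
        ≤ n * n ^ d * (cauchyConst d / (n * ‖u‖) ^ (d + 1)) := by
          unfold cauchyDensity
          rw [norm_smul, Real.norm_of_nonneg hn.le]
          gcongr
      _ = cauchyConst d / ‖u‖ ^ (d + 1) := by
          rw [mul_pow, pow_succ n d]; field_simp

/-! ### The squared field and the Poincaré inequality -/

section Poincare

variable {d : ℕ} {f : EuclideanSpace ℝ (Fin d) → ℝ} {M L : ℝ}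

lemma abs_sub_mul_sub_le {g : EuclideanSpace ℝ (Fin d) → ℝ} {M' L' : ℝ}
    (hM : ∀ x, |f x| ≤ M) (hL : ∀ x u, |f (x + u) - f x| ≤ L * ‖u‖)
    (hM' : ∀ x, |g x| ≤ M') (hL' : ∀ x u, |g (x + u) - g x| ≤ L' * ‖u‖)
    (x u : EuclideanSpace ℝ (Fin d)) :
    |(f (x + u) - f x) * (g (x + u) - g x)| ≤
      max (|L| * |L'|) (4 * |M| * |M'|) * levyWeight u := by
  have b1 : |f (x + u) - f x| ≤ |L| * ‖u‖ :=
    (hL x u).trans (mul_le_mul_of_nonneg_right (le_abs_self _) (norm_nonneg _))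
  have b2 : |g (x + u) - g x| ≤ |L'| * ‖u‖ :=
    (hL' x u).trans (mul_le_mul_of_nonneg_right (le_abs_self _) (norm_nonneg _))
  have c1 : |f (x + u) - f x| ≤ 2 * |M| := by
    have := abs_sub (f (x + u)) (f x)
    linarith [hM (x + u), hM x, le_abs_self M]
  have c2 : |g (x + u) - g x| ≤ 2 * |M'| := by
    have := abs_sub (g (x + u)) (g x)
    linarith [hM' (x + u), hM' x, le_abs_self M']
  rw [abs_mul]
  refine le_mul_levyWeight (le_max_of_le_left (by positivity)) ?_ ?_
  · calc _ ≤ (|L| * ‖u‖) * (|L'| * ‖u‖) := by gcongr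
      _ = |L| * |L'| * ‖u‖ ^ 2 := by ring
      _ ≤ _ := by gcongr; exact le_max_left _ _
  · calc _ ≤ (2 * |M|) * (2 * |M'|) := by gcongr
      _ = 4 * |M| * |M'| := by ring
      _ ≤ _ := le_max_right _ _

lemma integrable_squaredField {g : EuclideanSpace ℝ (Fin d) → ℝ} {M' L' : ℝ} (hd : 1 ≤ d)
    (hf : Continuous f) (hg : Continuous g)
    (hM : ∀ x, |f x| ≤ M) (hL : ∀ x u, |f (x + u) - f x| ≤ L * ‖u‖)
    (hM' : ∀ x, |g x| ≤ M') (hL' : ∀ x u, |g (x + u) - g x| ≤ L' * ‖u‖)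
    (x : EuclideanSpace ℝ (Fin d)) :
    Integrable (fun u => (f (x + u) - f x) * (g (x + u) - g x)) (levyMeasure d) := by
  refine ((integrable_levyWeight hd).const_mul
    (max (|L| * |L'|) (4 * |M| * |M'|))).mono' ?_ ?_
  · apply Continuous.aestronglyMeasurable; fun_prop
  · exact Eventually.of_forall fun u => abs_sub_mul_sub_le hM hL hM' hL' x u

lemma exists_abs_squaredField_le {g : EuclideanSpace ℝ (Fin d) → ℝ} {M' L' : ℝ} (hd : 1 ≤ d)
    (hM : ∀ x, |f x| ≤ M) (hL : ∀ x u, |f (x + u) - f x| ≤ L * ‖u‖)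
    (hM' : ∀ x, |g x| ≤ M') (hL' : ∀ x u, |g (x + u) - g x| ≤ L' * ‖u‖) :
    ∃ C, ∀ x, |squaredField d f g x| ≤ C :=
  ⟨∫ u, max (|L| * |L'|) (4 * |M| * |M'|) * levyWeight u ∂(levyMeasure d), fun x => by
    unfold squaredField
    rw [← Real.norm_eq_abs]
    exact norm_integral_le_of_norm_le ((integrable_levyWeight hd).const_mul _)
      (Eventually.of_forall fun u => abs_sub_mul_sub_le hM hL hM' hL' x u)⟩

lemma continuous_squaredField {g : EuclideanSpace ℝ (Fin d) → ℝ} {M' L' : ℝ} (hd : 1 ≤ d)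
    (hf : Continuous f) (hg : Continuous g)
    (hM : ∀ x, |f x| ≤ M) (hL : ∀ x u, |f (x + u) - f x| ≤ L * ‖u‖)
    (hM' : ∀ x, |g x| ≤ M') (hL' : ∀ x u, |g (x + u) - g x| ≤ L' * ‖u‖) :
    Continuous (squaredField d f g) := by
  refine continuous_of_dominated (bound := fun u =>
    max (|L| * |L'|) (4 * |M| * |M'|) * levyWeight u)
    (fun x => (integrable_squaredField hd hf hg hM hL hM' hL' x).aestronglyMeasurable)
    (fun x => Eventually.of_forall fun u => abs_sub_mul_sub_le hM hL hM' hL' x u)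
    ((integrable_levyWeight hd).const_mul _)
    (Eventually.of_forall fun u => by fun_prop)

/-- The Poincaré inequality for the Cauchy law. -/
theorem variance_le_integral_squaredField (hd : 1 ≤ d) (hf : Continuous f)
    (hM : ∀ x, |f x| ≤ M) (hL : ∀ x u, |f (x + u) - f x| ≤ L * ‖u‖) :
    ∫ x, f x ^ 2 ∂(cauchyMeasure d) - (∫ x, f x ∂(cauchyMeasure d)) ^ 2 ≤
      ∫ x, squaredField d f f x ∂(cauchyMeasure d) := by
  obtain ⟨C, hC⟩ := exists_abs_squaredField_le hd hM hL hM hL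
  let F : EuclideanSpace ℝ (Fin d) →ᵇ ℝ := BoundedContinuousFunction.ofNormedAddCommGroup f hf M hM
  let G : EuclideanSpace ℝ (Fin d) →ᵇ ℝ := BoundedContinuousFunction.ofNormedAddCommGroup
    (squaredField d f f) (continuous_squaredField hd hf hf hM hL hM hL) C hC
  have key : ∀ n : ℕ, ∫ x, f x ^ 2 ∂(cauchyMeasure d) - (∫ x, f x ∂(cauchyMeasure d)) ^ 2 ≤
      ∫ u, squaredField d f f ((n * ((n : ℝ) + 1)⁻¹) • u) ∂(cauchyMeasure d) := by
    intro n
    have hn : (0 : ℝ) < n + 1 := by positivity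
    -- With `n+1` steps of scale `ε`, the semigroup reaches scale one, and its value at the origin
    -- is integration against the Cauchy law.
    set ε := ((n : ℝ) + 1)⁻¹ with hε
    have hε0 : 0 ≤ ε := by positivity
    have h1 := translateAverage_iterate_variance_le (scaledCauchy d ε) n F 0
    have h2 : ((n : ℝ) + 1) • translateVariance (scaledCauchy d ε) F ≤ G := by
      intro x
      change ((n : ℝ) + 1) * translateVariance (scaledCauchy d ε) F x ≤ squaredField d f f x
      have h3 : translateVariance (scaledCauchy d ε) F x ≤
          ∫ u, (f (x + ε • u) - f x) ^ 2 ∂(cauchyMeasure d) := by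
        have h4 : translateVariance (scaledCauchy d ε) F x +
            (translateAverage (scaledCauchy d ε) F x - f x) ^ 2 =
            ∫ u, (f (x + u) - f x) ^ 2 ∂(scaledCauchy d ε) :=
          translateVariance_add_sq (scaledCauchy d ε) F x (f x)
        have h5 : ∫ u, (f (x + u) - f x) ^ 2 ∂(scaledCauchy d ε) =
            ∫ u, (f (x + ε • u) - f x) ^ 2 ∂(cauchyMeasure d) := by
          unfold scaledCauchy
          rw [integral_map (by fun_prop)
            (by apply Continuous.aestronglyMeasurable; fun_prop)]
        have h6 := sq_nonneg (translateAverage (scaledCauchy d ε) F x - f x)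
        linarith
      refine (mul_le_mul_of_nonneg_left h3 hn.le).trans ?_
      have := mul_integral_scaled_le hd hn (φ := fun u => (f (x + u) - f x) ^ 2)
        (fun u => sq_nonneg _) (by
          simpa only [sq] using integrable_squaredField hd hf hf hM hL hM hL x)
      simpa only [squaredField, sq] using this
    -- The factor `n+1` is absorbed into the Lévy measure, leaving the average of `Γ(f,f)` at scale
    -- `n ε`, slightly below one. This discrepancy vanishes in the limit.
    have h3 : ((n : ℝ) + 1) • (translateAverage (scaledCauchy d ε) ^ n)
        (translateVariance (scaledCauchy d ε) F) ≤ translateAverage (scaledCauchy d (n * ε)) G := by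
      rw [← map_smul, translateAverage_scaledCauchy_pow d hε0]
      exact monotone_translateAverage _ h2
    have h4 := h1.trans (h3 0)
    have e1 : ∀ g : EuclideanSpace ℝ (Fin d) →ᵇ ℝ,
        (translateAverage (scaledCauchy d ε) ^ (n + 1)) g 0 = ∫ x, g x ∂(cauchyMeasure d) := by
      intro g
      rw [translateAverage_scaledCauchy_pow d hε0, translateAverage_scaledCauchy_apply]
      have : ((n + 1 : ℕ) : ℝ) * ε = 1 := by push_cast; exact mul_inv_cancel₀ hn.ne'
      simp only [this, one_smul, zero_add]
    change (translateAverage (scaledCauchy d ε) ^ (n + 1)) (F ^ 2) 0 -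
      ((translateAverage (scaledCauchy d ε) ^ (n + 1)) F 0) ^ 2 ≤
      translateAverage (scaledCauchy d (n * ε)) G 0 at h4
    rw [e1, e1, translateAverage_scaledCauchy_apply] at h4
    simp only [zero_add] at h4
    exact h4
  have hlim : Tendsto (fun n : ℕ => ∫ u, squaredField d f f ((n * ((n : ℝ) + 1)⁻¹) • u)
      ∂(cauchyMeasure d)) atTop (𝓝 (∫ u, squaredField d f f u ∂(cauchyMeasure d))) := by
    have hGc : Continuous (squaredField d f f) := G.continuous
    refine tendsto_integral_of_dominated_convergence (fun _ => C)
      (fun n => by apply Continuous.aestronglyMeasurable; fun_prop) (integrable_const _)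
      (fun n => Eventually.of_forall fun u => hC _) (Eventually.of_forall fun u => ?_)
    have h1 : Tendsto (fun n : ℕ => (n : ℝ) * ((n : ℝ) + 1)⁻¹) atTop (𝓝 1) := by
      simpa [div_eq_mul_inv] using tendsto_natCast_div_add_atTop (𝕜 := ℝ) 1
    have h2 := h1.smul_const u
    rw [one_smul] at h2
    exact (hGc.tendsto u).comp h2
  exact ge_of_tendsto' hlim key

end Poincare

/-! ### Pointwise bounds for the generator -/

section Bracket

variable {d : ℕ}

/-- The Japanese bracket `√(1 + ‖x‖²)`. -/
def bracket (x : EuclideanSpace ℝ (Fin d)) : ℝ := √(1 + ‖x‖ ^ 2)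

lemma bracket_sq (x : EuclideanSpace ℝ (Fin d)) : bracket x ^ 2 = 1 + ‖x‖ ^ 2 :=
  Real.sq_sqrt (by positivity)

lemma one_le_bracket (x : EuclideanSpace ℝ (Fin d)) : 1 ≤ bracket x :=
  Real.one_le_sqrt.2 (by nlinarith [sq_nonneg ‖x‖])

lemma bracket_pos (x : EuclideanSpace ℝ (Fin d)) : 0 < bracket x :=
  one_pos.trans_le (one_le_bracket x)

lemma norm_le_bracket (x : EuclideanSpace ℝ (Fin d)) : ‖x‖ ≤ bracket x :=
  Real.le_sqrt_of_sq_le (by linarith)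

lemma bracket_rpow (x : EuclideanSpace ℝ (Fin d)) (s : ℝ) :
    (1 + ‖x‖ ^ 2) ^ (s / 2) = bracket x ^ s := by
  rw [← bracket_sq, ← Real.rpow_natCast, ← Real.rpow_mul (bracket_pos x).le]
  congr 1; push_cast; ring

lemma cauchyDensity_eq (x : EuclideanSpace ℝ (Fin d)) :
    cauchyDensity d x = cauchyConst d / bracket x ^ (d + 1) := by
  rw [cauchyDensity, bracket_rpow, ← Real.rpow_natCast]; push_cast; rfl

lemma bracket_add_le (x u : EuclideanSpace ℝ (Fin d)) : bracket (x + u) ≤ bracket x + ‖u‖ := by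
  have h1 := norm_add_le x u
  have h2 := norm_le_bracket x
  have h3 := bracket_sq x
  have h4 := bracket_pos x
  refine Real.sqrt_le_iff.2 ⟨by positivity, ?_⟩
  nlinarith [norm_nonneg (x + u), norm_nonneg u, norm_nonneg x,
    mul_le_mul_of_nonneg_right h2 (norm_nonneg u)]

lemma bracket_le_add (x u : EuclideanSpace ℝ (Fin d)) : bracket x ≤ bracket (x + u) + ‖u‖ := by
  simpa using bracket_add_le (x + u) (-u)

lemma norm_le_bracket_add (x u : EuclideanSpace ℝ (Fin d)) :
    ‖u‖ ≤ bracket x + bracket (x + u) := by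
  have := norm_sub_le (x + u) x
  rw [add_sub_cancel_left] at this
  linarith [norm_le_bracket x, norm_le_bracket (x + u)]

lemma cauchyDensity_le (x : EuclideanSpace ℝ (Fin d)) : |cauchyDensity d x| ≤ cauchyConst d := by
  rw [abs_of_pos (cauchyDensity_pos d x), cauchyDensity_eq]
  exact div_le_self (cauchyConst_pos d).le (one_le_pow₀ (one_le_bracket x))

/-- The bracket is 1-Lipschitz and at least one, so the `d`-th power produced by differencing
`(d+1)`-st powers is absorbed by the denominators. -/
lemma cauchyDensity_lipschitz (x u : EuclideanSpace ℝ (Fin d)) :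
    |cauchyDensity d (x + u) - cauchyDensity d x| ≤ cauchyConst d * (d + 1) * ‖u‖ := by
  have hc := cauchyConst_pos d
  have ha := bracket_pos x
  have hb := bracket_pos (x + u)
  have h1 := abs_pow_sub_pow_le (bracket x) (bracket (x + u)) (d + 1)
  have h2 : |bracket x - bracket (x + u)| ≤ ‖u‖ := by
    rw [abs_le]; constructor <;> linarith [bracket_add_le x u, bracket_le_add x u]
  have h3 : max |bracket x| |bracket (x + u)| ^ d ≤ bracket x ^ (d + 1) * bracket (x + u) ^ (d + 1) := by
    rw [abs_of_pos ha, abs_of_pos hb]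
    have h1a := one_le_pow₀ (one_le_bracket x) (n := d + 1)
    have h1b := one_le_pow₀ (one_le_bracket (x + u)) (n := d + 1)
    rcases max_cases (bracket x) (bracket (x + u)) with ⟨h, _⟩ | ⟨h, _⟩ <;> rw [h]
    · exact (pow_le_pow_right₀ (one_le_bracket x) (Nat.le_succ d)).trans
        (le_mul_of_one_le_right (by positivity) h1b)
    · exact (pow_le_pow_right₀ (one_le_bracket _) (Nat.le_succ d)).trans
        (le_mul_of_one_le_left (by positivity) h1a)
  have e : cauchyDensity d (x + u) - cauchyDensity d x = cauchyConst d *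
      (bracket x ^ (d + 1) - bracket (x + u) ^ (d + 1)) /
      (bracket x ^ (d + 1) * bracket (x + u) ^ (d + 1)) := by
    rw [cauchyDensity_eq, cauchyDensity_eq]; field_simp
  rw [e, abs_div, abs_mul, abs_of_pos hc,
    abs_of_pos (by positivity : 0 < bracket x ^ (d + 1) * bracket (x + u) ^ (d + 1)),
    div_le_iff₀ (by positivity)]
  simp only [add_tsub_cancel_right] at h1
  calc _ ≤ cauchyConst d * (‖u‖ * ((d + 1 : ℕ) : ℝ) *
        (bracket x ^ (d + 1) * bracket (x + u) ^ (d + 1))) := by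
        refine mul_le_mul_of_nonneg_left (h1.trans ?_) hc.le
        gcongr
    _ = _ := by push_cast; ring

end Bracket

/-- The cancellation behind the kernel estimate. The condition `|a - b| ≤ r` saves one factor `b` in
`a^(d+1) - b^(d+1)`, and `r ≤ b` does so for `r^(d+1)`. Only triangle-type inequalities enter, so
the lemma also applies with `b` and `r` exchanged. -/
lemma abs_pow_sub_pow_sub_pow_le (d : ℕ) {a b r : ℝ} (ha : 0 ≤ a) (hb : 0 ≤ b) (hr : 0 ≤ r)
    (h1 : a ≤ b + r) (h2 : b ≤ a + r) (hrb : r ≤ b) :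
    |a ^ (d + 1) - b ^ (d + 1) - r ^ (d + 1)| ≤ ((d + 1) * 2 ^ d + 1) * (r * b ^ d) := by
  have h3 := abs_pow_sub_pow_le a b (d + 1)
  simp only [add_tsub_cancel_right] at h3
  have h4 : max |a| |b| ≤ 2 * b := by
    rw [abs_of_nonneg ha, abs_of_nonneg hb]; exact max_le (by linarith) (by linarith)
  have h5 : |a - b| ≤ r := by rw [abs_le]; constructor <;> linarith
  have h6 : |a ^ (d + 1) - b ^ (d + 1)| ≤ r * ((d + 1 : ℕ) : ℝ) * (2 * b) ^ d :=
    h3.trans (by gcongr)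
  have h7 : r ^ (d + 1) ≤ r * b ^ d := by rw [pow_succ']; gcongr
  have h8 := abs_sub (a ^ (d + 1) - b ^ (d + 1)) (r ^ (d + 1))
  rw [abs_of_nonneg (by positivity : 0 ≤ r ^ (d + 1))] at h8
  rw [mul_pow] at h6
  push_cast at h6
  nlinarith

/-! ### Uniform bound for the kernel of `Γ(p,f)/p + f - ∫ f dμ` -/

section Kernel

variable {d : ℕ}

lemma levyWeight_of_norm_le_one {u : EuclideanSpace ℝ (Fin d)} (h : ‖u‖ ≤ 1) :
    levyWeight u = ‖u‖ ^ 2 := by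
  refine le_antisymm (min_le_left _ _) ?_
  have := le_mul_levyWeight (u := u) (t := ‖u‖ ^ 2) zero_le_one (by simp)
    (pow_le_one₀ (norm_nonneg _) h)
  simpa using this

lemma levyWeight_of_one_le_norm {u : EuclideanSpace ℝ (Fin d)} (h : 1 ≤ ‖u‖) :
    levyWeight u = ‖u‖ ^ (3 / 4 : ℝ) := by
  refine min_eq_right ?_
  rw [← Real.rpow_natCast]
  exact Real.rpow_le_rpow_of_exponent_le h (by norm_num)

/-- A translation-bounded majorant of the kernel of `f ↦ Γ(p, f) / p + f`. -/
def kernelBound (x u : EuclideanSpace ℝ (Fin d)) : ℝ :=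
  ‖u‖ ^ (3 / 4 : ℝ) / (‖u‖ ^ d * max 1 ‖u‖) + (1 + ‖x + u‖ ^ 2) ^ (-((d : ℝ) + 1 / 4) / 2)

lemma integrable_kernelBound_left (hd : 1 ≤ d) : Integrable fun u : EuclideanSpace ℝ (Fin d) =>
    ‖u‖ ^ (3 / 4 : ℝ) / (‖u‖ ^ d * max 1 ‖u‖) := by
  refine integrable_radial hd (φ := fun y => y ^ (3 / 4 : ℝ) / (y ^ d * max 1 y))
    (C := 1) (a := -(1 / 4)) (b := -(5 / 4)) (by norm_num) (by norm_num) ?_ ?_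
  · rintro y ⟨hy0, hy1⟩
    simp only [max_eq_left hy1.le]
    obtain ⟨k, rfl⟩ : ∃ k, d = k + 1 := ⟨d - 1, by omega⟩
    rw [show (-(1 / 4) : ℝ) = 3 / 4 - 1 by norm_num, Real.rpow_sub hy0, Real.rpow_one,
      add_tsub_cancel_right, pow_succ]
    field_simp
  · intro y hy
    have hy1 : 1 < y := hy
    have hy0 : 0 < y := one_pos.trans hy1
    simp only [max_eq_right hy1.le]
    obtain ⟨k, rfl⟩ : ∃ k, d = k + 1 := ⟨d - 1, by omega⟩
    rw [show (-(5 / 4) : ℝ) = 3 / 4 - 2 by norm_num, Real.rpow_sub hy0,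
      add_tsub_cancel_right, pow_succ]
    norm_cast
    field_simp

lemma integrable_kernelBound_right : Integrable fun y : EuclideanSpace ℝ (Fin d) =>
    (1 + ‖y‖ ^ 2) ^ (-((d : ℝ) + 1 / 4) / 2) :=
  integrable_rpow_neg_one_add_norm_sq (by rw [finrank_euclideanSpace_fin]; linarith)

lemma integrable_kernelBound (hd : 1 ≤ d) (x : EuclideanSpace ℝ (Fin d)) :
    Integrable (kernelBound x) :=
  (integrable_kernelBound_left hd).add (integrable_kernelBound_right.comp_add_left x)

/-- Only the second summand depends on `x`, and only through a translation. This makes the final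
error bound uniform in `x`. -/
lemma integral_kernelBound (hd : 1 ≤ d) (x : EuclideanSpace ℝ (Fin d)) :
    ∫ u, kernelBound x u = ∫ u, kernelBound (d := d) 0 u := by
  have h : ∀ x : EuclideanSpace ℝ (Fin d), ∫ u, kernelBound x u =
      (∫ u : EuclideanSpace ℝ (Fin d), ‖u‖ ^ (3 / 4 : ℝ) / (‖u‖ ^ d * max 1 ‖u‖)) +
      ∫ y : EuclideanSpace ℝ (Fin d), (1 + ‖y‖ ^ 2) ^ (-((d : ℝ) + 1 / 4) / 2) := by
    intro x
    unfold kernelBound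
    rw [integral_add (integrable_kernelBound_left hd)
      (integrable_kernelBound_right.comp_add_left x)]
    congr 1
    exact integral_add_left_eq_self (fun y : EuclideanSpace ℝ (Fin d) =>
      (1 + ‖y‖ ^ 2) ^ (-((d : ℝ) + 1 / 4) / 2)) x
  rw [h, h]

/-- In terms of the two brackets and `r = ‖u‖`, the kernel has numerator `a^(d+1) - b^(d+1) -
r^(d+1)`, which is small relative to the denominator. The two summands of `kernelBound` dominate the
cases `r ≤ b` and `b ≤ r` respectively. -/
lemma abs_kernel_mul_le {x u : EuclideanSpace ℝ (Fin d)} {B t : ℝ} (hB : 0 ≤ B)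
    (ht : |t| ≤ B * ‖u‖ ^ (3 / 4 : ℝ)) :
    |(cauchyConst d / ‖u‖ ^ (d + 1) * (cauchyDensity d (x + u) / cauchyDensity d x - 1) -
      cauchyDensity d (x + u)) * t| ≤
      cauchyConst d * ((d + 1) * 2 ^ d + 1) * B * kernelBound x u := by
  have hc := cauchyConst_pos d
  rcases eq_or_ne u 0 with rfl | hu
  · have : t = 0 := by simpa using ht
    rw [this, mul_zero, abs_zero]
    unfold kernelBound
    positivity
  set r := ‖u‖ with hr
  set a := bracket x with ha
  set b := bracket (x + u) with hb
  have hr0 : 0 < r := norm_pos_iff.2 hu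
  have ha0 : 0 < a := bracket_pos x
  have hb0 : 0 < b := bracket_pos _
  have hb1 : 1 ≤ b := one_le_bracket _
  have t1 : a ≤ b + r := bracket_le_add x u
  have t2 : b ≤ a + r := bracket_add_le x u
  have t3 : r ≤ a + b := norm_le_bracket_add x u
  have e : cauchyConst d / r ^ (d + 1) * (cauchyDensity d (x + u) / cauchyDensity d x - 1) -
      cauchyDensity d (x + u) = cauchyConst d * (a ^ (d + 1) - b ^ (d + 1) - r ^ (d + 1)) /
        (b ^ (d + 1) * r ^ (d + 1)) := by
    rw [cauchyDensity_eq, cauchyDensity_eq, ← ha, ← hb]; field_simp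
  rw [e, abs_mul, abs_div, abs_mul, abs_of_pos hc,
    abs_of_pos (by positivity : 0 < b ^ (d + 1) * r ^ (d + 1))]
  set C : ℝ := (d + 1) * 2 ^ d + 1 with hC
  have hC0 : 0 < C := by positivity
  have k1 : 0 ≤ r ^ (3 / 4 : ℝ) / (r ^ d * max 1 r) := by positivity
  have k2 : 0 ≤ (1 + ‖x + u‖ ^ 2) ^ (-((d : ℝ) + 1 / 4) / 2) := by positivity
  rcases le_total r b with h | h
  · have h1 := abs_pow_sub_pow_sub_pow_le d ha0.le hb0.le hr0.le t1 t2 h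
    calc _ ≤ cauchyConst d * (C * (r * b ^ d)) / (b ^ (d + 1) * r ^ (d + 1)) *
          (B * r ^ (3 / 4 : ℝ)) := by gcongr
      _ = cauchyConst d * C * B * (r ^ (3 / 4 : ℝ) / (r ^ d * b)) := by
          rw [pow_succ, pow_succ]; field_simp
      _ ≤ cauchyConst d * C * B * (r ^ (3 / 4 : ℝ) / (r ^ d * max 1 r)) := by
          gcongr; exact max_le hb1 h
      _ ≤ _ := by
          unfold kernelBound
          refine mul_le_mul_of_nonneg_left ?_ (by positivity)
          exact le_add_of_nonneg_right k2
  -- Here `x + u` is closer to the origin than `u` is long, so `r` and `b` exchange roles. The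
  -- leftover `r^(-1/4)` is at most `b^(-1/4)`, which makes the bound a function of `x + u` alone.
  · have h1 := abs_pow_sub_pow_sub_pow_le d ha0.le hr0.le hb0.le (by linarith) (by linarith) h
    rw [sub_right_comm] at h1
    have h2 : (1 + ‖x + u‖ ^ 2) ^ (-((d : ℝ) + 1 / 4) / 2) = (b ^ d)⁻¹ * b ^ (-(1 / 4) : ℝ) := by
      rw [bracket_rpow, ← hb, ← Real.rpow_natCast, ← Real.rpow_neg hb0.le, ← Real.rpow_add hb0]
      congr 1; ring
    calc _ ≤ cauchyConst d * (C * (b * r ^ d)) / (b ^ (d + 1) * r ^ (d + 1)) *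
          (B * r ^ (3 / 4 : ℝ)) := by gcongr
      _ = cauchyConst d * C * B * ((b ^ d)⁻¹ * r ^ (-(1 / 4) : ℝ)) := by
          rw [show (-(1 / 4) : ℝ) = 3 / 4 - 1 by norm_num, Real.rpow_sub hr0, Real.rpow_one,
            pow_succ, pow_succ]
          field_simp
      _ ≤ cauchyConst d * C * B * ((b ^ d)⁻¹ * b ^ (-(1 / 4) : ℝ)) := by
          have := Real.rpow_le_rpow_of_nonpos hb0 h (by norm_num : (-(1 / 4) : ℝ) ≤ 0)
          gcongr
      _ ≤ _ := by
          rw [← h2]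
          unfold kernelBound
          refine mul_le_mul_of_nonneg_left ?_ (by positivity)
          exact le_add_of_nonneg_left k1

end Kernel

/-- Regularity class for which the generator is estimated: a bounded Lipschitz `C¹` function
with a Hölder bound `B` and a second-order Taylor bound `K`. -/
structure IsTame {d : ℕ} (f : EuclideanSpace ℝ (Fin d) → ℝ) (B K : ℝ) : Prop where
  contDiff : ContDiff ℝ 1 f
  bounded : ∃ M, ∀ x, |f x| ≤ M
  lipschitz : ∃ L, ∀ x u, |f (x + u) - f x| ≤ L * ‖u‖
  holder : ∀ x u, |f (x + u) - f x| ≤ B * ‖u‖ ^ (3 / 4 : ℝ)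
  taylor : ∀ x u, |f (x + u) - f x - fderiv ℝ f x u| ≤ K * ‖u‖ ^ 2

namespace IsTame

variable {d : ℕ} {f : EuclideanSpace ℝ (Fin d) → ℝ} {B K : ℝ}

lemma continuous (h : IsTame f B K) : Continuous f := h.contDiff.continuous

lemma continuous_fderiv (h : IsTame f B K) : Continuous (fderiv ℝ f) :=
  h.contDiff.continuous_fderiv one_ne_zero

lemma nonneg_of_nontrivial (hd : 1 ≤ d) (h : IsTame f B K) : 0 ≤ B ∧ 0 ≤ K := by
  set e : EuclideanSpace ℝ (Fin d) := EuclideanSpace.single ⟨0, hd⟩ 1 with he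
  have hn : ‖e‖ = 1 := by simp [he]
  have h1 := (abs_nonneg _).trans (h.holder 0 e)
  have h2 := (abs_nonneg _).trans (h.taylor 0 e)
  rw [hn] at h1 h2
  simp at h1 h2
  exact ⟨h1, h2⟩

lemma abs_opA_integrand_le (hd : 1 ≤ d) (h : IsTame f B K) (x u : EuclideanSpace ℝ (Fin d)) :
    |f (x + u) - f x - (Metric.closedBall (0 : EuclideanSpace ℝ (Fin d)) 1).indicator
      (fun v => fderiv ℝ f x v) u| ≤ (B + K) * levyWeight u := by
  obtain ⟨hB, hK⟩ := h.nonneg_of_nontrivial hd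
  rcases le_or_gt ‖u‖ 1 with hu | hu
  · rw [indicator_of_mem (by simpa using hu), levyWeight_of_norm_le_one hu]
    refine (h.taylor x u).trans ?_
    gcongr; linarith
  · rw [indicator_of_notMem (by simpa using hu), levyWeight_of_one_le_norm hu.le, sub_zero]
    refine (h.holder x u).trans ?_
    gcongr; linarith

lemma stronglyMeasurable_opA_integrand (h : IsTame f B K) :
    StronglyMeasurable fun z : EuclideanSpace ℝ (Fin d) × EuclideanSpace ℝ (Fin d) =>
      f (z.1 + z.2) - f z.1 - (Metric.closedBall (0 : EuclideanSpace ℝ (Fin d)) 1).indicator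
      (fun v => fderiv ℝ f z.1 v) z.2 := by
  have hf := h.continuous
  have hf' := h.continuous_fderiv
  have e : (fun z : EuclideanSpace ℝ (Fin d) × EuclideanSpace ℝ (Fin d) =>
      (Metric.closedBall (0 : EuclideanSpace ℝ (Fin d)) 1).indicator
      (fun v => fderiv ℝ f z.1 v) z.2) =
      (Prod.snd ⁻¹' (Metric.closedBall (0 : EuclideanSpace ℝ (Fin d)) 1)).indicator
      (fun z => fderiv ℝ f z.1 z.2) := by
    ext z; simp [indicator]
  refine StronglyMeasurable.sub (Continuous.stronglyMeasurable (by fun_prop)) ?_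
  rw [e]
  refine StronglyMeasurable.indicator (Continuous.stronglyMeasurable (by fun_prop)) ?_
  exact measurable_snd Metric.isClosed_closedBall.measurableSet

lemma integrable_opA (hd : 1 ≤ d) (h : IsTame f B K) (x : EuclideanSpace ℝ (Fin d)) :
    Integrable (fun u => f (x + u) - f x -
      (Metric.closedBall (0 : EuclideanSpace ℝ (Fin d)) 1).indicator
      (fun v => fderiv ℝ f x v) u) (levyMeasure d) :=
  ((integrable_levyWeight hd).const_mul (B + K)).mono'
    (h.stronglyMeasurable_opA_integrand.comp_measurable measurable_prodMk_left).aestronglyMeasurable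
    (Eventually.of_forall fun u => h.abs_opA_integrand_le hd x u)

lemma stronglyMeasurable_opA (h : IsTame f B K) : StronglyMeasurable (opA d f) :=
  h.stronglyMeasurable_opA_integrand.integral_prod_right'

lemma abs_opA_le (hd : 1 ≤ d) (h : IsTame f B K) (x : EuclideanSpace ℝ (Fin d)) :
    |opA d f x| ≤ (B + K) * ∫ u, levyWeight u ∂(levyMeasure d) := by
  unfold opA
  rw [← integral_const_mul, ← Real.norm_eq_abs]
  exact norm_integral_le_of_norm_le ((integrable_levyWeight hd).const_mul _)
    (Eventually.of_forall fun u => h.abs_opA_integrand_le hd x u)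

lemma integrable_squaredField_density (hd : 1 ≤ d) (h : IsTame f B K)
    (x : EuclideanSpace ℝ (Fin d)) :
    Integrable (fun u => (cauchyDensity d (x + u) - cauchyDensity d x) * (f (x + u) - f x))
      (levyMeasure d) := by
  obtain ⟨M, hM⟩ := h.bounded
  obtain ⟨L, hL⟩ := h.lipschitz
  exact integrable_squaredField hd (continuous_cauchyDensity d) h.continuous cauchyDensity_le
    cauchyDensity_lipschitz hM hL x

lemma stronglyMeasurable_opL (hd : 1 ≤ d) (h : IsTame f B K) :
    StronglyMeasurable (opL d f) := by
  obtain ⟨M, hM⟩ := h.bounded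
  obtain ⟨L, hL⟩ := h.lipschitz
  have h1 := (continuous_squaredField hd (continuous_cauchyDensity d) h.continuous
    cauchyDensity_le cauchyDensity_lipschitz hM hL).stronglyMeasurable
  have h2 : StronglyMeasurable fun x => 1 / cauchyDensity d x :=
    (continuous_const.div (continuous_cauchyDensity d)
      fun x => (cauchyDensity_pos d x).ne').stronglyMeasurable
  exact (stronglyMeasurable_const.mul h.stronglyMeasurable_opA).add (h2.mul h1)

end IsTame

lemma integral_cauchyDensity (d : ℕ) : ∫ x, cauchyDensity d x = 1 := by
  have := integral_cauchyMeasure d (fun _ => (1 : ℝ))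
  simpa using this.symm

namespace IsTame

variable {d : ℕ} {f : EuclideanSpace ℝ (Fin d) → ℝ} {B K : ℝ}

/-- Since `p` has integral one, `f x - ∫ f dμ` equals minus the integral of `p(x+u) (f(x+u) - f x)`
in `u`, and so it merges with `Γ(p,f)/p` into a single kernel. -/
lemma squaredField_div_add (hd : 1 ≤ d) (h : IsTame f B K) (x : EuclideanSpace ℝ (Fin d)) :
    1 / cauchyDensity d x * squaredField d (cauchyDensity d) f x + f x -
      ∫ y, f y ∂(cauchyMeasure d) =
    ∫ u, (cauchyConst d / ‖u‖ ^ (d + 1) * (cauchyDensity d (x + u) / cauchyDensity d x - 1) -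
      cauchyDensity d (x + u)) * (f (x + u) - f x) := by
  obtain ⟨M, hM⟩ := h.bounded
  have hpx := cauchyDensity_pos d x
  have i1 := (integrable_levyMeasure_iff d).1 (h.integrable_squaredField_density hd x)
  have i2 : Integrable (fun u => cauchyDensity d (x + u) * f (x + u)) := by
    have : Integrable (fun y => cauchyDensity d y * f y) :=
      (integrable_cauchyDensity d).mul_bdd (c := M) h.continuous.aestronglyMeasurable
        (Eventually.of_forall hM)
    exact this.comp_add_left x
  have i3 : Integrable (fun u => cauchyDensity d (x + u)) :=
    (integrable_cauchyDensity d).comp_add_left x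
  have e2 : ∫ u, cauchyDensity d (x + u) * f (x + u) = ∫ y, f y ∂(cauchyMeasure d) := by
    rw [integral_cauchyMeasure]
    exact integral_add_left_eq_self (fun y => cauchyDensity d y * f y) x
  have e3 : ∫ u, cauchyDensity d (x + u) = 1 := by
    rw [← integral_cauchyDensity d]
    exact integral_add_left_eq_self (cauchyDensity d) x
  have e : ∀ u, (cauchyConst d / ‖u‖ ^ (d + 1) *
      (cauchyDensity d (x + u) / cauchyDensity d x - 1) -
      cauchyDensity d (x + u)) * (f (x + u) - f x) =
      1 / cauchyDensity d x * (cauchyConst d / ‖u‖ ^ (d + 1) *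
        ((cauchyDensity d (x + u) - cauchyDensity d x) * (f (x + u) - f x))) -
      (cauchyDensity d (x + u) * f (x + u) - f x * cauchyDensity d (x + u)) := by
    intro u
    have : cauchyDensity d (x + u) / cauchyDensity d x - 1 = 1 / cauchyDensity d x *
        (cauchyDensity d (x + u) - cauchyDensity d x) := by field_simp
    rw [this]; ring
  simp only [e]
  have i4 : Integrable (fun u => cauchyDensity d (x + u) * f (x + u) -
      f x * cauchyDensity d (x + u)) := i2.sub (i3.const_mul _)
  rw [integral_sub (i1.const_mul _) i4, integral_sub i2 (i3.const_mul _),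
    integral_const_mul, integral_const_mul, e2, e3, squaredField, integral_levyMeasure]
  ring

end IsTame

/-- The generator acts on tame functions as `-1` up to a bounded error. -/
lemma exists_abs_opL_add_le {d : ℕ} (hd : 1 ≤ d) : ∃ C, 0 ≤ C ∧
    ∀ (f : EuclideanSpace ℝ (Fin d) → ℝ) (B K : ℝ), IsTame f B K → ∀ x,
      |opL d f x + f x - ∫ y, f y ∂(cauchyMeasure d)| ≤ C * (B + K) := by
  have hc := cauchyConst_pos d
  set C₁ := ∫ u, levyWeight u ∂(levyMeasure d) with hC₁
  set C₂ := cauchyConst d * ((d + 1) * 2 ^ d + 1) * ∫ u, kernelBound (d := d) 0 u with hC₂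
  have h1 : 0 ≤ C₁ := integral_nonneg fun u => levyWeight_nonneg u
  have h2 : 0 ≤ C₂ := by
    have : 0 ≤ ∫ u, kernelBound (d := d) 0 u := integral_nonneg fun u => by
      unfold kernelBound; simp only [Pi.zero_apply]; positivity
    positivity
  refine ⟨2 * C₁ + C₂, by positivity, fun f B K h x => ?_⟩
  obtain ⟨hB, hK⟩ := h.nonneg_of_nontrivial hd
  have h3 := h.abs_opA_le hd x
  have h4 : |1 / cauchyDensity d x * squaredField d (cauchyDensity d) f x + f x -
      ∫ y, f y ∂(cauchyMeasure d)| ≤ C₂ * B := by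
    rw [h.squaredField_div_add hd x, ← Real.norm_eq_abs]
    refine (norm_integral_le_of_norm_le (((integrable_kernelBound hd x).const_mul
      (cauchyConst d * ((d + 1) * 2 ^ d + 1) * B)))
      (Eventually.of_forall fun u => abs_kernel_mul_le hB (h.holder x u))).trans ?_
    rw [integral_const_mul, integral_kernelBound hd, hC₂]
    apply le_of_eq; ring
  have e : opL d f x + f x - ∫ y, f y ∂(cauchyMeasure d) = 2 * opA d f x +
      (1 / cauchyDensity d x * squaredField d (cauchyDensity d) f x + f x -
      ∫ y, f y ∂(cauchyMeasure d)) := by unfold opL; ring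
  rw [e]
  refine (abs_add_le _ _).trans ?_
  rw [abs_mul, abs_two]
  have : C₂ * B ≤ C₂ * (B + K) := by gcongr; linarith
  linarith

/-! ### Integration by parts -/

lemma measurePreserving_neg_levyMeasure (d : ℕ) :
    MeasurePreserving (fun u : EuclideanSpace ℝ (Fin d) => -u) (levyMeasure d) (levyMeasure d) := by
  refine ⟨measurable_neg, ?_⟩
  ext s hs
  have h := (Measure.measurePreserving_neg
    (volume : Measure (EuclideanSpace ℝ (Fin d)))).setLIntegral_comp_preimage hs
    (measurable_levyDensity d).ennreal_ofReal
  rw [Measure.map_apply measurable_neg hs, levyMeasure, withDensity_apply _ hs,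
    withDensity_apply _ (measurable_neg hs), ← h]
  simp only [norm_neg]

/-- The exchange `(x, x + u) ↦ (x + u, x)` in the coordinates `(u, x)`. -/
lemma measurePreserving_exchange (d : ℕ) :
    MeasurePreserving (fun z : EuclideanSpace ℝ (Fin d) × EuclideanSpace ℝ (Fin d) =>
      (-z.1, z.2 + z.1)) ((levyMeasure d).prod volume) ((levyMeasure d).prod volume) :=
  (measurePreserving_neg_levyMeasure d).skew_product (g := fun u x => x + u) (by fun_prop)
    (Eventually.of_forall fun u => map_add_right_eq_self volume u)

namespace IsTame

variable {d : ℕ} {f : EuclideanSpace ℝ (Fin d) → ℝ} {B K : ℝ}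

theorem integral_mul_opL (hd : 1 ≤ d) (h : IsTame f B K) (hf : Integrable f) :
    ∫ x, f x * opL d f x ∂(cauchyMeasure d) = -∫ x, squaredField d f f x ∂(cauchyMeasure d) := by
  obtain ⟨M, hM⟩ := h.bounded
  obtain ⟨L, hL⟩ := h.lipschitz
  obtain ⟨hB, hK⟩ := h.nonneg_of_nontrivial hd
  have hc := cauchyConst_pos d
  have hfc := h.continuous
  have hfc' := h.continuous_fderiv
  have hpc := continuous_cauchyDensity d
  set p := cauchyDensity d with hp
  set I : EuclideanSpace ℝ (Fin d) → EuclideanSpace ℝ (Fin d) → ℝ := fun x u =>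
    (Metric.closedBall (0 : EuclideanSpace ℝ (Fin d)) 1).indicator (fun v => fderiv ℝ f x v) u
    with hI
  set Φ : EuclideanSpace ℝ (Fin d) × EuclideanSpace ℝ (Fin d) → ℝ := fun z =>
    f z.2 * (2 * p z.2 * (f (z.2 + z.1) - f z.2 - I z.2 z.1) +
      (p (z.2 + z.1) - p z.2) * (f (z.2 + z.1) - f z.2)) with hΦ
  set Ψ : EuclideanSpace ℝ (Fin d) × EuclideanSpace ℝ (Fin d) → ℝ := fun z =>
    p z.2 * ((f (z.2 + z.1) - f z.2) * (f (z.2 + z.1) - f z.2)) with hΨ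
  set T : EuclideanSpace ℝ (Fin d) × EuclideanSpace ℝ (Fin d) →
    EuclideanSpace ℝ (Fin d) × EuclideanSpace ℝ (Fin d) := fun z => (-z.1, z.2 + z.1) with hT
  have hTp := measurePreserving_exchange d
  have hΦm : StronglyMeasurable Φ := by
    have h1 := h.stronglyMeasurable_opA_integrand.comp_measurable
      (measurable_swap (α := EuclideanSpace ℝ (Fin d)) (β := EuclideanSpace ℝ (Fin d)))
    refine (hfc.comp continuous_snd).stronglyMeasurable.mul
      (StronglyMeasurable.add (StronglyMeasurable.mul ?_ h1) ?_)
    · exact Continuous.stronglyMeasurable (by fun_prop)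
    · exact Continuous.stronglyMeasurable (by fun_prop)
  have hw := integrable_levyWeight hd
  have iΦ : Integrable Φ ((levyMeasure d).prod volume) := by
    have hb := (hw.const_mul (2 * cauchyConst d * (B + K) +
      max (|cauchyConst d * (d + 1)| * |L|) (4 * |cauchyConst d| * |M|))).mul_prod hf.norm
    refine hb.mono' hΦm.aestronglyMeasurable (Eventually.of_forall fun z => ?_)
    have h1 := h.abs_opA_integrand_le hd z.2 z.1
    have h2 := abs_sub_mul_sub_le cauchyDensity_le cauchyDensity_lipschitz hM hL z.2 z.1
    have h3 := cauchyDensity_le z.2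
    rw [Real.norm_eq_abs, hΦ]
    simp only
    rw [abs_mul, mul_comm, Real.norm_eq_abs]
    refine mul_le_mul_of_nonneg_right ?_ (abs_nonneg _)
    refine (abs_add_le _ _).trans ?_
    rw [abs_mul, abs_mul, abs_two, add_mul]
    refine add_le_add ?_ h2
    calc _ ≤ 2 * cauchyConst d * ((B + K) * levyWeight z.1) := by
          gcongr
      _ = _ := by ring
  have iΨ : Integrable Ψ ((levyMeasure d).prod volume) := by
    have hb := (hw.const_mul (max (|L| * |L|) (4 * |M| * |M|))).mul_prod
      (integrable_cauchyDensity d)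
    refine hb.mono' (Continuous.aestronglyMeasurable (by fun_prop))
      (Eventually.of_forall fun z => ?_)
    rw [Real.norm_eq_abs, hΨ]
    simp only
    rw [abs_mul, mul_comm, abs_of_pos (cauchyDensity_pos d z.2)]
    exact mul_le_mul_of_nonneg_right (abs_sub_mul_sub_le hM hL hM hL z.2 z.1)
      (cauchyDensity_pos d z.2).le
  have eT : ∀ {F : EuclideanSpace ℝ (Fin d) × EuclideanSpace ℝ (Fin d) → ℝ},
      Integrable F ((levyMeasure d).prod volume) →
      Integrable (fun z => F (T z)) ((levyMeasure d).prod volume) ∧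
      ∫ z, F (T z) ∂((levyMeasure d).prod volume) = ∫ z, F z ∂((levyMeasure d).prod volume) := by
    intro F hF
    refine ⟨(hTp.integrable_comp hF.aestronglyMeasurable).2 hF, ?_⟩
    have hF' : AEStronglyMeasurable F (((levyMeasure d).prod volume).map T) := by
      rw [hTp.map_eq]; exact hF.aestronglyMeasurable
    rw [← integral_map hTp.measurable.aemeasurable hF', hTp.map_eq]
  -- `S` collects the gradient compensators left after symmetrization; all the other terms of `Φ`
  -- and `Ψ` cancel under the exchange.
  set S : EuclideanSpace ℝ (Fin d) × EuclideanSpace ℝ (Fin d) → ℝ := fun z =>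
    p z.2 * f z.2 * I z.2 z.1 - p (z.2 + z.1) * f (z.2 + z.1) * I (z.2 + z.1) z.1 with hS
  have key : ∀ z, Φ z + Φ (T z) + (Ψ z + Ψ (T z)) = -2 * S z := by
    intro z
    have hneg : I (z.2 + z.1) (-z.1) = -I (z.2 + z.1) z.1 := by
      simp only [hI, indicator, Metric.mem_closedBall, dist_zero_right, norm_neg, map_neg]
      split_ifs <;> simp
    simp only [hΦ, hΨ, hT, hS, hneg, add_neg_cancel_right]
    ring
  obtain ⟨iΦT, eΦT⟩ := eT iΦ
  obtain ⟨iΨT, eΨT⟩ := eT iΨ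
  -- Integrability is read off from the identity `key`: a single compensator is only of first order
  -- in `u`, too large near the origin to be dominated by `levyWeight`.
  have iS : Integrable S ((levyMeasure d).prod volume) := by
    have := ((iΦ.add iΦT).add (iΨ.add iΨT)).const_mul (-(1 / 2))
    refine this.congr (Eventually.of_forall fun z => ?_)
    have := key z
    simp only [Pi.add_apply]
    linarith
  have hS0 : ∫ z, S z ∂((levyMeasure d).prod volume) = 0 := by
    rw [integral_prod _ iS]
    -- For fixed `u`, `S` is the difference between an integrable function of `x` and its translate
    -- by `u`.
    have : ∀ u, ∫ x, S (u, x) = 0 := by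
      intro u
      have hi : Integrable (fun x => p x * f x * I x u) := by
        simp only [hI, indicator]
        split_ifs
        · have h1 : Integrable (fun x => (p x * fderiv ℝ f x u) * f x) := by
            refine hf.bdd_mul (c := cauchyConst d * (L * ‖u‖ + K * ‖u‖ ^ 2))
              (Continuous.aestronglyMeasurable (by fun_prop)) (Eventually.of_forall fun x => ?_)
            rw [norm_mul]
            refine mul_le_mul (cauchyDensity_le x) ?_ (norm_nonneg _) hc.le
            have h2 := h.taylor x u
            have h3 := hL x u
            rw [Real.norm_eq_abs]
            rw [abs_le] at h2 h3 ⊢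
            constructor <;> linarith
          refine h1.congr (Eventually.of_forall fun x => by simp only; ring)
        · simp
      have e := integral_add_right_eq_self (μ := (volume : Measure (EuclideanSpace ℝ (Fin d))))
        (fun x => p x * f x * I x u) u
      change ∫ x, (p x * f x * I x u - p (x + u) * f (x + u) * I (x + u) u) = 0
      rw [integral_sub hi (hi.comp_add_right u), e, sub_self]
    simp [this]
  have main : ∫ z, Φ z ∂((levyMeasure d).prod volume) =
      -∫ z, Ψ z ∂((levyMeasure d).prod volume) := by
    have h1 : ∫ z, (Φ z + Φ (T z) + (Ψ z + Ψ (T z))) ∂((levyMeasure d).prod volume) = 0 := by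
      simp only [key]
      rw [integral_const_mul, hS0, mul_zero]
    have iA : Integrable (fun z => Φ z + Φ (T z)) ((levyMeasure d).prod volume) := iΦ.add iΦT
    have iB : Integrable (fun z => Ψ z + Ψ (T z)) ((levyMeasure d).prod volume) := iΨ.add iΨT
    rw [integral_add iA iB, integral_add iΦ iΦT, integral_add iΨ iΨT,
      eΦT, eΨT] at h1
    linarith
  rw [integral_prod_symm _ iΦ, integral_prod_symm _ iΨ] at main
  rw [integral_cauchyMeasure, integral_cauchyMeasure]
  convert main using 1
  · refine integral_congr_ae (Eventually.of_forall fun x => ?_)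
    have i1 := (h.integrable_opA hd x).const_mul (2 * p x)
    have i2 := h.integrable_squaredField_density hd x
    simp only [hΦ]
    rw [integral_const_mul, integral_add i1 i2, integral_const_mul]
    have hpx : p x ≠ 0 := (cauchyDensity_pos d x).ne'
    rw [opL, ← hp, smul_eq_mul]
    change _ = f x * (2 * p x * opA d f x + squaredField d p f x)
    field_simp
  · congr 1
    refine integral_congr_ae (Eventually.of_forall fun x => ?_)
    simp only [hΨ]
    rw [integral_const_mul]
    rfl

/-- The spectral gap inequality. -/
theorem eLpNorm_le_eLpNorm_opL (hd : 1 ≤ d) (h : IsTame f B K) (hf : Integrable f)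
    (h0 : ∫ x, f x ∂(cauchyMeasure d) = 0) :
    eLpNorm f 2 (cauchyMeasure d) ≤ eLpNorm (opL d f) 2 (cauchyMeasure d) := by
  obtain ⟨M, hM⟩ := h.bounded
  obtain ⟨L, hL⟩ := h.lipschitz
  obtain ⟨C, -, hC⟩ := exists_abs_opL_add_le hd
  have m1 : MemLp f 2 (cauchyMeasure d) :=
    MemLp.of_bound h.continuous.aestronglyMeasurable M (Eventually.of_forall hM)
  have m2 : MemLp (opL d f) 2 (cauchyMeasure d) := by
    refine MemLp.of_bound (h.stronglyMeasurable_opL hd).aestronglyMeasurable (C * (B + K) + M)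
      (Eventually.of_forall fun x => ?_)
    have h1 := hC f B K h x
    have h2 := hM x
    rw [h0, sub_zero] at h1
    rw [Real.norm_eq_abs]
    rw [abs_le] at h1 h2 ⊢
    constructor <;> linarith
  have hP := variance_le_integral_squaredField hd h.continuous hM hL
  rw [h0, ← neg_neg (∫ x, squaredField d f f x ∂(cauchyMeasure d)),
    ← h.integral_mul_opL hd hf] at hP
  have i1 : Integrable (fun x => f x ^ 2) (cauchyMeasure d) := m1.integrable_sq
  have i2 : Integrable (fun x => opL d f x ^ 2) (cauchyMeasure d) := m2.integrable_sq
  have i3 : Integrable (fun x => f x * opL d f x) (cauchyMeasure d) := m1.integrable_mul m2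
  have hle : ∫ x, f x ^ 2 ∂(cauchyMeasure d) ≤ ∫ x, opL d f x ^ 2 ∂(cauchyMeasure d) := by
    -- Expanding `‖f + L f‖² ≥ 0` and using `‖f‖² ≤ -⟨f, L f⟩` replaces Cauchy–Schwarz.
    have h1 : 0 ≤ ∫ x, (f x + opL d f x) ^ 2 ∂(cauchyMeasure d) :=
      integral_nonneg fun x => sq_nonneg _
    have e : ∀ x, (f x + opL d f x) ^ 2 = f x ^ 2 + 2 * (f x * opL d f x) + opL d f x ^ 2 :=
      fun x => by ring
    have i4 : Integrable (fun x => f x ^ 2 + 2 * (f x * opL d f x)) (cauchyMeasure d) :=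
      i1.add (i3.const_mul 2)
    simp only [e] at h1
    rw [integral_add i4 i2, integral_add i1 (i3.const_mul 2), integral_const_mul] at h1
    linarith
  rw [m1.eLpNorm_eq_integral_rpow_norm (by norm_num) (by norm_num),
    m2.eLpNorm_eq_integral_rpow_norm (by norm_num) (by norm_num)]
  refine ENNReal.ofReal_le_ofReal ?_
  have e2 : ∀ y : ℝ, ‖y‖ ^ (2 : ℝ) = y ^ 2 := fun y => by
    rw [Real.norm_eq_abs, ← sq_abs]; norm_cast
  simp only [ENNReal.toReal_ofNat, e2]
  have : 0 ≤ ∫ x, f x ^ 2 ∂(cauchyMeasure d) := integral_nonneg fun x => sq_nonneg _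
  gcongr

end IsTame

open scoped SchwartzMap

/-! ### Schwartz functions -/

lemma exists_schwartz_bound {E F : Type*} [NormedAddCommGroup E] [NormedSpace ℝ E]
    [NormedAddCommGroup F] [NormedSpace ℝ F] (f : 𝓢(E, F)) : ∃ C, 0 ≤ C ∧ ∀ x, ‖f x‖ ≤ C :=
  ⟨SchwartzMap.seminorm ℝ 0 0 f, apply_nonneg _ _, fun x => SchwartzMap.norm_le_seminorm ℝ f x⟩

lemma exists_schwartz_lipschitz {E F : Type*} [NormedAddCommGroup E] [NormedSpace ℝ E]
    [NormedAddCommGroup F] [NormedSpace ℝ F] (f : 𝓢(E, F)) :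
    ∃ C, 0 ≤ C ∧ ∀ x u, ‖f (x + u) - f x‖ ≤ C * ‖u‖ := by
  obtain ⟨C, hC0, hC⟩ := exists_schwartz_bound (SchwartzMap.fderivCLM ℝ E F f)
  refine ⟨C, hC0, fun x u => ?_⟩
  have := convex_univ.norm_image_sub_le_of_norm_fderiv_le (𝕜 := ℝ) (f := f) (C := C)
    (fun x _ => f.differentiableAt) (fun x _ => hC x) (mem_univ x) (mem_univ (x + u))
  simpa using this

lemma exists_schwartz_taylor {E F : Type*} [NormedAddCommGroup E] [NormedSpace ℝ E]
    [NormedAddCommGroup F] [NormedSpace ℝ F] (f : 𝓢(E, F)) :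
    ∃ C, 0 ≤ C ∧ ∀ x u, ‖f (x + u) - f x - fderiv ℝ f x u‖ ≤ C * ‖u‖ ^ 2 := by
  obtain ⟨C, hC0, hC⟩ := exists_schwartz_lipschitz (SchwartzMap.fderivCLM ℝ E F f)
  refine ⟨C, hC0, fun x u => ?_⟩
  have := (convex_closedBall x ‖u‖).norm_image_sub_le_of_norm_fderiv_le' (𝕜 := ℝ) (f := f)
    (C := C * ‖u‖) (φ := fderiv ℝ f x) (x := x) (y := x + u) (fun x _ => f.differentiableAt)
    (fun y hy => ?_) (by simp) (by simp)
  · simpa [sq, mul_assoc] using this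
  · have h1 := hC x (y - x)
    rw [add_sub_cancel] at h1
    refine h1.trans (mul_le_mul_of_nonneg_left ?_ hC0)
    simpa [dist_eq_norm] using hy

/-- The Hölder constant interpolates between the Lipschitz and the uniform bound: an increment `t`
is `t^(3/4) t^(1/4)`, with `t ≤ L ‖u‖` in the first factor and `t ≤ 2M` in the second. -/
lemma IsTame.of_bounds {d : ℕ} {f : EuclideanSpace ℝ (Fin d) → ℝ} {M L K : ℝ}
    (hf : ContDiff ℝ 1 f) (hL0 : 0 ≤ L) (hM : ∀ x, |f x| ≤ M)
    (hL : ∀ x u, |f (x + u) - f x| ≤ L * ‖u‖)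
    (hK : ∀ x u, |f (x + u) - f x - fderiv ℝ f x u| ≤ K * ‖u‖ ^ 2) :
    IsTame f (L ^ (3 / 4 : ℝ) * (2 * M) ^ (1 / 4 : ℝ)) K where
  contDiff := hf
  bounded := ⟨M, hM⟩
  lipschitz := ⟨L, hL⟩
  holder x u := by
    have h1 : |f (x + u) - f x| ≤ 2 * M := by
      have := abs_sub (f (x + u)) (f x)
      linarith [hM (x + u), hM x]
    have h2 : |f (x + u) - f x| =
        |f (x + u) - f x| ^ (3 / 4 : ℝ) * |f (x + u) - f x| ^ (1 / 4 : ℝ) := by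
      rw [← Real.rpow_add_of_nonneg (abs_nonneg _) (by norm_num) (by norm_num)]
      norm_num
    calc |f (x + u) - f x|
        = |f (x + u) - f x| ^ (3 / 4 : ℝ) * |f (x + u) - f x| ^ (1 / 4 : ℝ) := h2
      _ ≤ (L * ‖u‖) ^ (3 / 4 : ℝ) * (2 * M) ^ (1 / 4 : ℝ) := by
          have := hL x u
          gcongr
      _ = _ := by rw [Real.mul_rpow hL0 (norm_nonneg _)]; ring
  taylor := hK

lemma exists_isTame {d : ℕ} (f : 𝓢(EuclideanSpace ℝ (Fin d), ℝ)) : ∃ B K, IsTame f B K := by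
  obtain ⟨M, -, hM⟩ := exists_schwartz_bound f
  obtain ⟨L, hL0, hL⟩ := exists_schwartz_lipschitz f
  obtain ⟨K, -, hK⟩ := exists_schwartz_taylor f
  exact ⟨_, _, IsTame.of_bounds (f.smooth 1) hL0 hM hL hK⟩

/-! ### The truncated coordinates -/

/-- The Gaussian `exp (-‖x‖²)` as a Schwartz function. -/
def gaussianSchwartz (E : Type*) [NormedAddCommGroup E] [InnerProductSpace ℝ E] : 𝓢(E, ℝ) where
  toFun x := Real.exp (-‖x‖ ^ 2)
  smooth' := Real.contDiff_exp.comp (contDiff_norm_sq ℝ).neg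
  decay' := by
    intro k n
    have hq : (fun x : E => -‖x‖ ^ 2).HasTemperateGrowth :=
      Function.HasTemperateGrowth.neg (Function.hasTemperateGrowth_norm_sq E)
    obtain ⟨m, C, hC0, hC⟩ := hq.norm_iteratedFDeriv_le_uniform n
    refine ⟨n.factorial * (C + 1) ^ n * ((k + m * n).factorial * Real.exp 2), fun x => ?_⟩
    have h1 : 1 ≤ 1 + ‖x‖ := by linarith [norm_nonneg x]
    have hD : 1 ≤ (C + 1) * (1 + ‖x‖) ^ m :=
      one_le_mul_of_one_le_of_one_le (by linarith) (one_le_pow₀ h1)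
    have h2 := norm_iteratedFDeriv_comp_le (𝕜 := ℝ) (g := Real.exp) (f := fun x : E => -‖x‖ ^ 2)
      (n := n) (N := ⊤) Real.contDiff_exp (contDiff_norm_sq ℝ).neg le_top x (C := Real.exp (-‖x‖ ^ 2))
      (D := (C + 1) * (1 + ‖x‖) ^ m)
      (fun i _ => by
        rw [norm_iteratedFDeriv_eq_norm_iteratedDeriv, iteratedDeriv_eq_iterate,
          Real.iter_deriv_exp, Real.norm_of_nonneg (Real.exp_pos _).le])
      (fun i hi hin => by
        refine (hC i hin x).trans ((?_ : _ ≤ (C + 1) * (1 + ‖x‖) ^ m).trans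
          (le_self_pow₀ hD (by omega)))
        gcongr; linarith)
    -- The exponential series absorbs the polynomial factor, at the cost of `exp (1 + ‖x‖ - ‖x‖²)`;
    -- that exponent is at most 5/4, hence below 2.
    have h3 : (1 + ‖x‖) ^ (k + m * n) * Real.exp (-‖x‖ ^ 2) ≤
        (k + m * n).factorial * Real.exp 2 := by
      have h4 := Real.pow_div_factorial_le_exp (1 + ‖x‖) (by positivity) (k + m * n)
      rw [div_le_iff₀ (by positivity)] at h4
      calc _ ≤ Real.exp (1 + ‖x‖) * (k + m * n).factorial * Real.exp (-‖x‖ ^ 2) := by gcongr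
        _ = (k + m * n).factorial * Real.exp (1 + ‖x‖ + -‖x‖ ^ 2) := by
            rw [Real.exp_add (1 + ‖x‖)]; ring
        _ ≤ _ := by
            gcongr
            nlinarith [sq_nonneg (‖x‖ - 1 / 2)]
    calc ‖x‖ ^ k * ‖iteratedFDeriv ℝ n (fun x : E => Real.exp (-‖x‖ ^ 2)) x‖
        ≤ (1 + ‖x‖) ^ k * (n.factorial * Real.exp (-‖x‖ ^ 2) *
          ((C + 1) * (1 + ‖x‖) ^ m) ^ n) := by
          refine mul_le_mul ?_ h2 (norm_nonneg _) (by positivity)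
          gcongr; linarith
      _ = n.factorial * (C + 1) ^ n * ((1 + ‖x‖) ^ (k + m * n) * Real.exp (-‖x‖ ^ 2)) := by
          rw [mul_pow, ← pow_mul, pow_add]; ring
      _ ≤ _ := by gcongr

lemma gaussianSchwartz_apply {E : Type*} [NormedAddCommGroup E] [InnerProductSpace ℝ E] (x : E) :
    gaussianSchwartz E x = Real.exp (-‖x‖ ^ 2) := rfl

lemma exists_schwartz_truncCoord_one (d : ℕ) (j : Fin d) :
    ∃ f : 𝓢(EuclideanSpace ℝ (Fin d), ℝ), ∀ x, f x = truncCoord d 1 j x := by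
  have hg : (fun x : EuclideanSpace ℝ (Fin d) => x j).HasTemperateGrowth :=
    (EuclideanSpace.proj (𝕜 := ℝ) j).hasTemperateGrowth
  refine ⟨SchwartzMap.smulLeftCLM ℝ (fun x : EuclideanSpace ℝ (Fin d) => x j)
    (gaussianSchwartz _), fun x => ?_⟩
  rw [SchwartzMap.smulLeftCLM_apply_apply hg]
  simp [gaussianSchwartz_apply, truncCoord]

lemma truncCoord_eq_scale {d : ℕ} {R : ℝ} (hR : R ≠ 0) (j : Fin d)
    (x : EuclideanSpace ℝ (Fin d)) : truncCoord d R j x = R * truncCoord d 1 j (R⁻¹ • x) := by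
  unfold truncCoord
  rw [norm_smul, mul_pow, Real.norm_eq_abs, sq_abs, PiLp.smul_apply, smul_eq_mul]
  rw [show R⁻¹ ^ 2 * ‖x‖ ^ 2 / 1 ^ 2 = ‖x‖ ^ 2 / R ^ 2 by field_simp]
  field_simp

lemma exists_schwartz_truncCoord {d : ℕ} {R : ℝ} (hR : R ≠ 0) (j : Fin d) :
    ∃ f : 𝓢(EuclideanSpace ℝ (Fin d), ℝ), ∀ x, f x = truncCoord d R j x := by
  obtain ⟨h, hh⟩ := exists_schwartz_truncCoord_one d j
  refine ⟨R • SchwartzMap.compCLMOfContinuousLinearEquiv ℝ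
    (ContinuousLinearEquiv.smulLeft (Units.mk0 R⁻¹ (inv_ne_zero hR))) h, fun x => ?_⟩
  rw [truncCoord_eq_scale hR, ← hh]
  rfl

/-- By scaling, `truncCoord d R j x = R h(x/R)` for a fixed Schwartz function `h`. The Lipschitz
constant is unchanged, the supremum grows like `R`, and the Taylor constant shrinks by `R⁻¹`;
interpolation yields the Hölder constant of order `R^(1/4)`. -/
lemma exists_isTame_truncCoord (d : ℕ) (j : Fin d) : ∃ B K : ℝ, ∀ R : ℝ, 1 ≤ R →
    IsTame (truncCoord d R j) (B * R ^ (1 / 4 : ℝ)) K := by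
  obtain ⟨h, hh⟩ := exists_schwartz_truncCoord_one d j
  obtain ⟨M, hM0, hM⟩ := exists_schwartz_bound h
  obtain ⟨L, hL0, hL⟩ := exists_schwartz_lipschitz h
  obtain ⟨K, hK0, hK⟩ := exists_schwartz_taylor h
  refine ⟨L ^ (3 / 4 : ℝ) * (2 * M) ^ (1 / 4 : ℝ), K, fun R hR => ?_⟩
  have hR0 : 0 < R := one_pos.trans_le hR
  have e : truncCoord d R j = fun x => R * h (R⁻¹ • x) := by
    ext x; rw [truncCoord_eq_scale hR0.ne', hh]
  have hd : ∀ x, HasFDerivAt (fun x => R * h (R⁻¹ • x)) (fderiv ℝ h (R⁻¹ • x)) x := by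
    intro x
    have h1 : HasFDerivAt (fun x : EuclideanSpace ℝ (Fin d) => R⁻¹ • x)
        (R⁻¹ • ContinuousLinearMap.id ℝ _) x := (hasFDerivAt_id x).const_smul R⁻¹
    have h2 := ((h.differentiableAt (x := R⁻¹ • x)).hasFDerivAt.comp x h1).const_mul R
    have h3 : R • (fderiv ℝ h (R⁻¹ • x)).comp (R⁻¹ • ContinuousLinearMap.id ℝ _) =
        fderiv ℝ h (R⁻¹ • x) := by
      ext v; simp [hR0.ne']
    rw [h3] at h2
    exact h2
  have := IsTame.of_bounds (f := truncCoord d R j) (M := M * R) (L := L) (K := K) ?_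
    hL0 ?_ ?_ ?_
  · rwa [← mul_assoc 2 M R, Real.mul_rpow (by positivity) hR0.le, ← mul_assoc] at this
  · rw [e]
    exact contDiff_const.mul ((h.smooth 1).comp (contDiff_const_smul _))
  · intro x
    rw [e, abs_mul, abs_of_pos hR0, mul_comm]
    exact mul_le_mul_of_nonneg_right (hM _) hR0.le
  · intro x u
    simp only [e]
    rw [← mul_sub, abs_mul, abs_of_pos hR0, smul_add]
    have := hL (R⁻¹ • x) (R⁻¹ • u)
    rw [norm_smul, Real.norm_of_nonneg (inv_nonneg.2 hR0.le)] at this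
    calc _ ≤ R * (L * (R⁻¹ * ‖u‖)) := mul_le_mul_of_nonneg_left this hR0.le
      _ = _ := by field_simp
  · intro x u
    simp only [e]
    rw [(hd x).fderiv]
    have := hK (R⁻¹ • x) (R⁻¹ • u)
    rw [norm_smul, Real.norm_of_nonneg (inv_nonneg.2 hR0.le), ← smul_add] at this
    have e2 : R * h (R⁻¹ • (x + u)) - R * h (R⁻¹ • x) - fderiv ℝ h (R⁻¹ • x) u =
        R * (h (R⁻¹ • (x + u)) - h (R⁻¹ • x) - fderiv ℝ h (R⁻¹ • x) (R⁻¹ • u)) := by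
      rw [(fderiv ℝ h (R⁻¹ • x)).map_smul, smul_eq_mul]; field_simp
    rw [e2, abs_mul, abs_of_pos hR0]
    calc _ ≤ R * (K * (R⁻¹ * ‖u‖) ^ 2) := mul_le_mul_of_nonneg_left this hR0.le
      _ = (K * ‖u‖ ^ 2) * R⁻¹ := by field_simp
      _ ≤ _ := mul_le_of_le_one_right (by positivity) (inv_le_one_of_one_le₀ hR)

/-- The coordinate is odd and the density even. -/
lemma integral_truncCoord (d : ℕ) (R : ℝ) (j : Fin d) :
    ∫ x, truncCoord d R j x ∂(cauchyMeasure d) = 0 := by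
  rw [integral_cauchyMeasure]
  have h := integral_neg_eq_self (fun x => cauchyDensity d x • truncCoord d R j x)
    (volume : Measure (EuclideanSpace ℝ (Fin d)))
  have h2 : ∀ x, cauchyDensity d (-x) • truncCoord d R j (-x) =
      -(cauchyDensity d x • truncCoord d R j x) := by
    intro x
    simp [cauchyDensity, truncCoord]
  simp only [h2, integral_neg] at h
  linarith

lemma eLpNorm_two_sq_eq {Ω : Type*} [MeasurableSpace Ω] {μ : Measure Ω} {f : Ω → ℝ}
    (hf : MemLp f 2 μ) : eLpNorm f 2 μ = ENNReal.ofReal √(∫ x, f x ^ 2 ∂μ) := by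
  rw [hf.eLpNorm_eq_integral_rpow_norm (by norm_num) (by norm_num), Real.sqrt_eq_rpow]
  have e2 : ∀ y : ℝ, ‖y‖ ^ (2 : ℝ) = y ^ 2 := fun y => by
    rw [Real.norm_eq_abs, ← sq_abs]; norm_cast
  simp only [ENNReal.toReal_ofNat, e2, one_div]

/-- At distance of order `R` the function is of order `R` on a ball of volume of order `R^d`, where
the density is of order `R^(-d-1)`; the squared norm is thus at least of order `R`. -/
lemma exists_le_eLpNorm_truncCoord (d : ℕ) (j : Fin d) : ∃ c : ℝ, 0 < c ∧ ∀ R : ℝ, 1 ≤ R →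
    ENNReal.ofReal (c * R ^ (1 / 2 : ℝ)) ≤ eLpNorm (truncCoord d R j) 2 (cauchyMeasure d) := by
  have hc := cauchyConst_pos d
  set v := (volume : Measure (EuclideanSpace ℝ (Fin d))).real (Metric.ball 0 1) with hv
  have hv0 : 0 < v := by
    refine ENNReal.toReal_pos (Metric.measure_ball_pos _ _ one_pos).ne' measure_ball_lt_top.ne
  set A := cauchyConst d / 2 ^ (d + 1) * ((1 / 2) ^ 2 * Real.exp (-2)) * ((1 / 8) ^ d * v) with hA
  have hA0 : 0 < A := by positivity
  obtain ⟨B, K, hBK⟩ := exists_isTame_truncCoord d j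
  refine ⟨√A, Real.sqrt_pos.2 hA0, fun R hR => ?_⟩
  have hR0 : 0 < R := one_pos.trans_le hR
  have ht := hBK R hR
  obtain ⟨M, hM⟩ := ht.bounded
  rw [eLpNorm_two_sq_eq (MemLp.of_bound ht.continuous.aestronglyMeasurable M
    (Eventually.of_forall hM)), ← Real.sqrt_eq_rpow, ← Real.sqrt_mul hA0.le]
  refine ENNReal.ofReal_le_ofReal (Real.sqrt_le_sqrt ?_)
  rw [integral_cauchyMeasure]
  -- On the ball of radius `R/8` about `x₀`, both `‖x‖ ≤ R` and `x j ≥ R/2` hold.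
  set x₀ : EuclideanSpace ℝ (Fin d) := EuclideanSpace.single j (3 * R / 4) with hx₀
  set s := Metric.closedBall x₀ (R / 8) with hs
  have hi : Integrable (fun x => cauchyDensity d x • truncCoord d R j x ^ 2) := by
    refine (integrable_cauchyDensity d).mul_bdd (c := M ^ 2)
      (ht.continuous.pow 2).aestronglyMeasurable (Eventually.of_forall fun x => ?_)
    rw [norm_pow]
    exact pow_le_pow_left₀ (norm_nonneg _) (hM x) 2
  have hb : ∀ x ∈ s, cauchyConst d / (2 * R) ^ (d + 1) * ((R / 2) ^ 2 * Real.exp (-2)) ≤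
      cauchyDensity d x • truncCoord d R j x ^ 2 := by
    intro x hx
    have hx' : ‖x - x₀‖ ≤ R / 8 := by rwa [← dist_eq_norm]
    have hx0 : ‖x₀‖ = 3 * R / 4 := by
      rw [hx₀, PiLp.norm_single, Real.norm_of_nonneg (by positivity)]
    have h1 : ‖x‖ ≤ R := by
      have := norm_sub_norm_le x x₀
      linarith
    have h2 : R / 2 ≤ x j := by
      have h3 := (PiLp.norm_apply_le (x - x₀) j).trans hx'
      rw [PiLp.sub_apply, hx₀, PiLp.single_apply, if_pos rfl, Real.norm_eq_abs,
        abs_le] at h3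
      linarith [h3.1]
    have h4 : bracket x ≤ 2 * R := by
      refine Real.sqrt_le_iff.2 ⟨by positivity, ?_⟩
      nlinarith [norm_nonneg x]
    have h5 : Real.exp (-2) ≤ Real.exp (-(‖x‖ ^ 2 / R ^ 2)) ^ 2 := by
      rw [← Real.exp_nat_mul]
      refine Real.exp_le_exp.2 ?_
      have : ‖x‖ ^ 2 / R ^ 2 ≤ 1 := by
        rw [div_le_one (by positivity)]
        gcongr
      push_cast; linarith
    rw [cauchyDensity_eq, truncCoord, smul_eq_mul, mul_pow (x j)]
    have := bracket_pos x
    gcongr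
  have h1 := setIntegral_ge_of_const_le_real Metric.isClosed_closedBall.measurableSet
    measure_closedBall_lt_top.ne hb hi.integrableOn
  have h2 : ∫ x in s, cauchyDensity d x • truncCoord d R j x ^ 2 ≤
      ∫ x, cauchyDensity d x • truncCoord d R j x ^ 2 :=
    setIntegral_le_integral hi (Eventually.of_forall fun x => by
      have := cauchyDensity_pos d x
      simp only [Pi.zero_apply, smul_eq_mul]; positivity)
  refine le_trans (le_of_eq ?_) (h1.trans h2)
  rw [Measure.addHaar_real_closedBall _ _ (by positivity), finrank_euclideanSpace_fin, ← hv, hA, mul_pow 2 R,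
    div_pow R 8, pow_succ R, one_div_pow 8]
  field_simp

/-! ### The Schwartz realization of the generator -/

section Linear

variable {d : ℕ} {f g : EuclideanSpace ℝ (Fin d) → ℝ} {B K B' K' : ℝ}

lemma opL_add (hd : 1 ≤ d) (hf : IsTame f B K) (hg : IsTame g B' K')
    (x : EuclideanSpace ℝ (Fin d)) :
    opL d (fun y => f y + g y) x = opL d f x + opL d g x := by
  have h1 : opA d (fun y => f y + g y) x = opA d f x + opA d g x := by
    unfold opA
    rw [← integral_add (hf.integrable_opA hd x) (hg.integrable_opA hd x)]
    refine integral_congr_ae (Eventually.of_forall fun u => ?_)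
    have e : fderiv ℝ (fun y => f y + g y) x = fderiv ℝ f x + fderiv ℝ g x :=
      fderiv_fun_add (hf.contDiff.differentiable one_ne_zero x)
        (hg.contDiff.differentiable one_ne_zero x)
    simp only [e, indicator, add_apply]
    split_ifs <;> ring
  have h2 : squaredField d (cauchyDensity d) (fun y => f y + g y) x =
      squaredField d (cauchyDensity d) f x + squaredField d (cauchyDensity d) g x := by
    unfold squaredField
    rw [← integral_add (hf.integrable_squaredField_density hd x)
      (hg.integrable_squaredField_density hd x)]
    exact integral_congr_ae (Eventually.of_forall fun u => by ring)
  unfold opL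
  rw [h1, h2]
  ring

lemma opL_const_mul (hf : IsTame f B K) (c : ℝ) (x : EuclideanSpace ℝ (Fin d)) :
    opL d (fun y => c * f y) x = c * opL d f x := by
  have h1 : opA d (fun y => c * f y) x = c * opA d f x := by
    unfold opA
    rw [← integral_const_mul]
    refine integral_congr_ae (Eventually.of_forall fun u => ?_)
    have e : fderiv ℝ (fun y => c * f y) x = c • fderiv ℝ f x :=
      fderiv_const_mul (hf.contDiff.differentiable one_ne_zero x) c
    simp only [e, indicator, smul_apply, smul_eq_mul]
    split_ifs <;> ring
  have h2 : squaredField d (cauchyDensity d) (fun y => c * f y) x =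
      c * squaredField d (cauchyDensity d) f x := by
    unfold squaredField
    rw [← integral_const_mul]
    exact integral_congr_ae (Eventually.of_forall fun u => by ring)
  unfold opL
  rw [h1, h2]
  ring

lemma IsTame.memLp_opL (hd : 1 ≤ d) (hf : IsTame f B K) :
    MemLp (opL d f) 2 (cauchyMeasure d) := by
  obtain ⟨M, hM⟩ := hf.bounded
  obtain ⟨C, -, hC⟩ := exists_abs_opL_add_le hd
  refine MemLp.of_bound (hf.stronglyMeasurable_opL hd).aestronglyMeasurable
    (C * (B + K) + M + |∫ y, f y ∂(cauchyMeasure d)|) (Eventually.of_forall fun x => ?_)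
  have h1 := hC f B K hf x
  have h2 := hM x
  have h3 := neg_abs_le (∫ y, f y ∂(cauchyMeasure d))
  have h4 := le_abs_self (∫ y, f y ∂(cauchyMeasure d))
  rw [Real.norm_eq_abs]
  rw [abs_le] at h1 h2 ⊢
  constructor <;> linarith

end Linear

lemma memLp_opL_schwartz {d : ℕ} (hd : 1 ≤ d) (f : 𝓢(EuclideanSpace ℝ (Fin d), ℝ)) :
    MemLp (opL d fun x => f x) 2 (cauchyMeasure d) := by
  obtain ⟨B, K, h⟩ := exists_isTame f
  exact h.memLp_opL hd

/-- The generator as a linear map from Schwartz functions to `L²`. -/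
def opLSchwartz {d : ℕ} (hd : 1 ≤ d) :
    𝓢(EuclideanSpace ℝ (Fin d), ℝ) →ₗ[ℝ] Lp ℝ 2 (cauchyMeasure d) where
  toFun f := (memLp_opL_schwartz hd f).toLp
  map_add' f g := by
    obtain ⟨B, K, hf⟩ := exists_isTame f
    obtain ⟨B', K', hg⟩ := exists_isTame g
    rw [← MemLp.toLp_add]
    exact MemLp.toLp_congr _ _ (Eventually.of_forall fun x => opL_add hd hf hg x)
  map_smul' c f := by
    obtain ⟨B, K, hf⟩ := exists_isTame f
    rw [RingHom.id_apply, ← MemLp.toLp_const_smul]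
    exact MemLp.toLp_congr _ _ (Eventually.of_forall fun x => opL_const_mul hf c x)

lemma coeFn_opLSchwartz {d : ℕ} (hd : 1 ≤ d) (f : 𝓢(EuclideanSpace ℝ (Fin d), ℝ)) :
    opLSchwartz hd f =ᵐ[cauchyMeasure d] opL d fun x => f x :=
  MemLp.coeFn_toLp (memLp_opL_schwartz hd f)

/-- Full support, from the positivity of the density, makes a Schwartz function recoverable from its
class. This is why the generator is well defined on classes. -/
instance isOpenPosMeasure_cauchyMeasure (d : ℕ) : (cauchyMeasure d).IsOpenPosMeasure := by
  refine Measure.AbsolutelyContinuous.isOpenPosMeasure (μ := volume)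
    (withDensity_absolutelyContinuous' (measurable_cauchyDensity d).ennreal_ofReal.aemeasurable
      (Eventually.of_forall fun x => ?_))
  simpa using cauchyDensity_pos d x

/-- The inclusion of Schwartz functions in `L²`. -/
def schwartzInclusion (d : ℕ) :
    𝓢(EuclideanSpace ℝ (Fin d), ℝ) →ₗ[ℝ] Lp ℝ 2 (cauchyMeasure d) :=
  (SchwartzMap.toLpCLM ℝ ℝ 2 (cauchyMeasure d)).toLinearMap

lemma coeFn_schwartzInclusion {d : ℕ} (f : 𝓢(EuclideanSpace ℝ (Fin d), ℝ)) :
    schwartzInclusion d f =ᵐ[cauchyMeasure d] fun x => f x :=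
  SchwartzMap.coeFn_toLp f 2 (cauchyMeasure d)

lemma injective_schwartzInclusion (d : ℕ) : Function.Injective (schwartzInclusion d) :=
  SchwartzMap.injective_toLp 2 (cauchyMeasure d)

/-- The generator with domain the Schwartz functions. -/
def schwartzGenerator {d : ℕ} (hd : 1 ≤ d) :
    Lp ℝ 2 (cauchyMeasure d) →ₗ.[ℝ] Lp ℝ 2 (cauchyMeasure d) where
  domain := LinearMap.range (schwartzInclusion d)
  toFun := opLSchwartz hd ∘ₗ
    (LinearEquiv.ofInjective (schwartzInclusion d) (injective_schwartzInclusion d)).symm.toLinearMap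

lemma schwartzGenerator_apply {d : ℕ} (hd : 1 ≤ d) (f : 𝓢(EuclideanSpace ℝ (Fin d), ℝ))
    (F : (schwartzGenerator hd).domain)
    (hF : (F : Lp ℝ 2 (cauchyMeasure d)) = schwartzInclusion d f) :
    schwartzGenerator hd F = opLSchwartz hd f := by
  change opLSchwartz hd ((LinearEquiv.ofInjective (schwartzInclusion d)
    (injective_schwartzInclusion d)).symm F) = _
  congr 1
  exact (LinearEquiv.symm_apply_eq _).2 (Subtype.ext hF)

lemma eq_schwartzInclusion_iff {d : ℕ} (F : Lp ℝ 2 (cauchyMeasure d))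
    (f : 𝓢(EuclideanSpace ℝ (Fin d), ℝ)) :
    F = schwartzInclusion d f ↔ F =ᵐ[cauchyMeasure d] fun x => f x :=
  ⟨fun h => h ▸ coeFn_schwartzInclusion f,
    fun h => Lp.ext (h.trans (coeFn_schwartzInclusion f).symm)⟩

lemma isSchwartzRealization_schwartzGenerator {d : ℕ} (hd : 1 ≤ d) :
    IsSchwartzRealization d (schwartzGenerator hd) := by
  refine ⟨fun F => ?_, fun F f hF => ?_⟩
  · change F ∈ LinearMap.range (schwartzInclusion d) ↔ _
    simp only [LinearMap.mem_range, ← eq_schwartzInclusion_iff, eq_comm]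
  · rw [schwartzGenerator_apply hd f F ((eq_schwartzInclusion_iff _ f).2 hF)]
    exact coeFn_opLSchwartz hd f

/-! ### Truncated coordinates are approximate eigenvectors -/

/-- The relative defect of `truncCoord` as an eigenvector for the eigenvalue `-1`. -/
def defectRatio (d : ℕ) (j : Fin d) (R : ℝ) : ℝ≥0∞ :=
  eLpNorm (fun x => opL d (truncCoord d R j) x + truncCoord d R j x) 2 (cauchyMeasure d) /
    eLpNorm (truncCoord d R j) 2 (cauchyMeasure d)

lemma tendsto_defectRatio {d : ℕ} (hd : 1 ≤ d) (j : Fin d) :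
    Tendsto (defectRatio d j) atTop (𝓝 0) := by
  obtain ⟨c, hc0, hc⟩ := exists_le_eLpNorm_truncCoord d j
  obtain ⟨B, K, hBK⟩ := exists_isTame_truncCoord d j
  obtain ⟨C, hC0, hC⟩ := exists_abs_opL_add_le hd
  have hK : 0 ≤ K := ((hBK 1 le_rfl).nonneg_of_nontrivial hd).2
  have hlim : Tendsto (fun R : ℝ => ENNReal.ofReal (C * (B + K) / c * R ^ (-(1 / 4) : ℝ))) atTop
      (𝓝 0) := by
    have h1 := (tendsto_rpow_neg_atTop (y := 1 / 4) (by norm_num)).const_mul (C * (B + K) / c)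
    rw [mul_zero] at h1
    simpa using ENNReal.tendsto_ofReal h1
  refine tendsto_of_tendsto_of_tendsto_of_le_of_le' tendsto_const_nhds hlim
    (Eventually.of_forall fun _ => zero_le) ?_
  filter_upwards [eventually_ge_atTop 1] with R hR
  have hR0 : 0 < R := one_pos.trans_le hR
  have h1 : ∀ x, ‖opL d (truncCoord d R j) x + truncCoord d R j x‖ ≤
      C * (B + K) * R ^ (1 / 4 : ℝ) := by
    intro x
    have h2 := hC _ _ _ (hBK R hR) x
    rw [integral_truncCoord, sub_zero] at h2
    refine h2.trans ?_
    rw [mul_assoc, add_mul]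
    have : K ≤ K * R ^ (1 / 4 : ℝ) :=
      le_mul_of_one_le_right hK (Real.one_le_rpow hR (by norm_num))
    gcongr
  have h3 := eLpNorm_le_of_ae_bound (p := 2) (μ := cauchyMeasure d) (Eventually.of_forall h1)
  simp only [measure_univ, ENNReal.one_rpow, one_mul] at h3
  calc defectRatio d j R ≤ ENNReal.ofReal (C * (B + K) * R ^ (1 / 4 : ℝ)) /
        ENNReal.ofReal (c * R ^ (1 / 2 : ℝ)) := ENNReal.div_le_div h3 (hc R hR)
    _ = ENNReal.ofReal (C * (B + K) / c * R ^ (-(1 / 4) : ℝ)) := by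
        rw [← ENNReal.ofReal_div_of_pos (by positivity)]
        congr 1
        rw [show (-(1 / 4) : ℝ) = 1 / 4 - 1 / 2 by norm_num, Real.rpow_sub hR0]
        field_simp

/-- The witnesses are normalized truncated coordinates with `R = n + 1`. They are Schwartz
functions, on which every extension agrees with the generator, so the defect is the same for all
extensions. -/
lemma neg_one_mem_approxPointSpectrum {d : ℕ} (hd : 1 ≤ d)
    {T : Lp ℝ 2 (cauchyMeasure d) →ₗ.[ℝ] Lp ℝ 2 (cauchyMeasure d)}
    (hT : schwartzGenerator hd ≤ T) : (-1 : ℝ) ∈ approxPointSpectrum T := by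
  set j : Fin d := ⟨0, hd⟩ with hj
  obtain ⟨c, hc0, hc⟩ := exists_le_eLpNorm_truncCoord d j
  have hR : ∀ n : ℕ, (1 : ℝ) ≤ n + 1 := fun n => by linarith [n.cast_nonneg (α := ℝ)]
  choose g hg using fun n : ℕ =>
    exists_schwartz_truncCoord (d := d) (R := (n : ℝ) + 1) (by linarith [hR n]) j
  have hge : ∀ n, (fun x => g n x) = truncCoord d ((n : ℝ) + 1) j := fun n => funext (hg n)
  have hdom : ∀ n, schwartzInclusion d (g n) ∈ (schwartzGenerator hd).domain := fun n =>
    LinearMap.mem_range_self _ _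
  have hn : ∀ n, ‖schwartzInclusion d (g n)‖ =
      (eLpNorm (truncCoord d ((n : ℝ) + 1) j) 2 (cauchyMeasure d)).toReal := by
    intro n
    rw [Lp.norm_def, eLpNorm_congr_ae (coeFn_schwartzInclusion (g n)), hge]
  have hpos : ∀ n, 0 < ‖schwartzInclusion d (g n)‖ := by
    intro n
    rw [norm_pos_iff]
    intro h0
    have h1 : eLpNorm (truncCoord d ((n : ℝ) + 1) j) 2 (cauchyMeasure d) = 0 := by
      rw [← hge, ← eLpNorm_congr_ae (coeFn_schwartzInclusion (g n)), h0]
      rw [eLpNorm_congr_ae (Lp.coeFn_zero ℝ 2 (cauchyMeasure d))]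
      exact eLpNorm_zero
    have h2 := hc _ (hR n)
    rw [h1, nonpos_iff_eq_zero, ENNReal.ofReal_eq_zero] at h2
    have : 0 < c * ((n : ℝ) + 1) ^ (1 / 2 : ℝ) := by positivity
    linarith
  refine ⟨fun n => ‖schwartzInclusion d (g n)‖⁻¹ • ⟨schwartzInclusion d (g n), hT.1 (hdom n)⟩,
    fun n => ?_, ?_⟩
  · rw [Submodule.coe_smul, norm_smul, norm_inv, norm_norm]
    exact inv_mul_cancel₀ (hpos n).ne'
  · have hT2 : ∀ n, T ⟨schwartzInclusion d (g n), hT.1 (hdom n)⟩ = opLSchwartz hd (g n) := by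
      intro n
      rw [← schwartzGenerator_apply hd (g n) ⟨schwartzInclusion d (g n), hdom n⟩ rfl]
      exact (hT.2 rfl).symm
    have hnorm : ∀ n, ‖opLSchwartz hd (g n) + schwartzInclusion d (g n)‖ =
        (eLpNorm (fun x => opL d (truncCoord d ((n : ℝ) + 1) j) x +
          truncCoord d ((n : ℝ) + 1) j x) 2 (cauchyMeasure d)).toReal := by
      intro n
      rw [Lp.norm_def]
      congr 1
      refine eLpNorm_congr_ae ((Lp.coeFn_add _ _).trans ?_)
      filter_upwards [coeFn_opLSchwartz hd (g n), coeFn_schwartzInclusion (g n)] with x h1 h2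
      rw [Pi.add_apply, h1, h2, hge, hg]
    have hlim : Tendsto (fun n : ℕ => (defectRatio d j ((n : ℝ) + 1)).toReal) atTop (𝓝 0) := by
      have h1 : Tendsto (fun n : ℕ => (n : ℝ) + 1) atTop atTop :=
        tendsto_atTop_add_const_right _ _ tendsto_natCast_atTop_atTop
      exact (ENNReal.tendsto_toReal ENNReal.zero_ne_top).comp ((tendsto_defectRatio hd j).comp h1)
    refine hlim.congr fun n => ?_
    rw [LinearPMap.map_smul, hT2, Submodule.coe_smul, neg_one_smul, sub_neg_eq_add, ← smul_add,
      norm_smul, norm_inv, norm_norm, hnorm, hn, defectRatio, ENNReal.toReal_div, div_eq_inv_mul]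

/-! ### The value of the functional `U` -/

lemma functionalU_le_one {d : ℕ} (hd : 1 ≤ d) : functionalU d (cauchyMeasure d) ≤ 1 := by
  refine iSup_le fun f => iSup_le fun _ => iSup_le fun h0 => ?_
  obtain ⟨B, K, h⟩ := exists_isTame f
  exact ENNReal.div_le_of_le_mul ((h.eLpNorm_le_eLpNorm_opL hd f.integrable h0).trans
    (by rw [one_mul]))

/-- The triangle inequality gives `‖L g‖ ≤ ‖g‖ (1 + defect)` for a truncated coordinate `g`, which
is centred and hence admissible; its quotient is at least `(1 + defect)⁻¹`, which tends to one. -/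
lemma one_le_functionalU {d : ℕ} (hd : 1 ≤ d) : 1 ≤ functionalU d (cauchyMeasure d) := by
  set j : Fin d := ⟨0, hd⟩ with hj
  obtain ⟨c, hc0, hc⟩ := exists_le_eLpNorm_truncCoord d j
  obtain ⟨B, K, hBK⟩ := exists_isTame_truncCoord d j
  have hlim : Tendsto (fun R => (1 + defectRatio d j R)⁻¹) atTop (𝓝 1) := by
    have h1 := (tendsto_defectRatio hd j).const_add 1
    rw [add_zero] at h1
    simpa using h1.inv
  refine le_of_tendsto hlim ?_
  filter_upwards [eventually_ge_atTop 1] with R hR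
  have hR0 : 0 < R := one_pos.trans_le hR
  obtain ⟨g, hg⟩ := exists_schwartz_truncCoord (d := d) hR0.ne' j
  have hge : (fun x => g x) = truncCoord d R j := funext hg
  set N := eLpNorm (truncCoord d R j) 2 (cauchyMeasure d) with hN
  have hN0 : N ≠ 0 := by
    have h1 : 0 < ENNReal.ofReal (c * R ^ (1 / 2 : ℝ)) := ENNReal.ofReal_pos.2 (by positivity)
    exact (h1.trans_le (hc R hR)).ne'
  have hNt : N ≠ ∞ := by
    obtain ⟨M, hM⟩ := (hBK R hR).bounded
    exact (MemLp.of_bound (hBK R hR).continuous.aestronglyMeasurable M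
      (Eventually.of_forall hM)).eLpNorm_ne_top
  have hg0 : g ≠ 0 := by
    rintro rfl
    refine hN0 ?_
    rw [hN, ← hge]
    simp
  have hle : (1 + defectRatio d j R)⁻¹ ≤ N / eLpNorm (opL d fun x => g x) 2 (cauchyMeasure d) := by
    rw [hge]
    have h1 : eLpNorm (opL d (truncCoord d R j)) 2 (cauchyMeasure d) ≤
        N * (1 + defectRatio d j R) := by
      rw [mul_add, mul_one, defectRatio, ← hN, ENNReal.mul_div_cancel hN0 hNt]
      have hm1 := ((hBK R hR).stronglyMeasurable_opL hd).aestronglyMeasurable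
        (μ := cauchyMeasure d)
      have hm2 := (hBK R hR).continuous.aestronglyMeasurable (μ := cauchyMeasure d)
      have := eLpNorm_sub_le (hm1.add hm2) hm2 (p := 2) (by norm_num)
      rw [add_sub_cancel_right, add_comm] at this
      exact this
    calc (1 + defectRatio d j R)⁻¹ = N / (N * (1 + defectRatio d j R)) := by
          rw [div_eq_mul_inv, ENNReal.mul_inv (Or.inl hN0) (Or.inl hNt), ← mul_assoc,
            ENNReal.mul_inv_cancel hN0 hNt, one_mul]
      _ ≤ _ := ENNReal.div_le_div_left h1 N
  refine hle.trans ?_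
  unfold functionalU
  refine le_trans ?_ (le_iSup _ g)
  refine le_trans ?_ (le_iSup _ hg0)
  refine le_trans ?_ (le_iSup _ (by rw [hge]; exact integral_truncCoord d R j))
  rw [hge]

end CauchyMehler

end

theorem mainTheorem11 (d : ℕ) (hd : 1 ≤ d) :
    (∀ j : Fin d,
      Tendsto
        (fun R : ℝ =>
          eLpNorm (fun x => CauchyMehler.opL d (CauchyMehler.truncCoord d R j) x
              + CauchyMehler.truncCoord d R j x) 2 (CauchyMehler.cauchyMeasure d) ^ 2
            / eLpNorm (CauchyMehler.truncCoord d R j) 2 (CauchyMehler.cauchyMeasure d) ^ 2)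
        atTop (𝓝 0)) ∧
    (∃ T₀ : Lp ℝ 2 (CauchyMehler.cauchyMeasure d) →ₗ.[ℝ] Lp ℝ 2 (CauchyMehler.cauchyMeasure d),
      CauchyMehler.IsSchwartzRealization d T₀ ∧
      ∀ T : Lp ℝ 2 (CauchyMehler.cauchyMeasure d) →ₗ.[ℝ] Lp ℝ 2 (CauchyMehler.cauchyMeasure d),
        T₀ ≤ T → (-1 : ℝ) ∈ CauchyMehler.approxPointSpectrum T) ∧
    CauchyMehler.functionalU d (CauchyMehler.cauchyMeasure d) = 1 := by
  refine ⟨fun j => ?_, ⟨CauchyMehler.schwartzGenerator hd,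
    CauchyMehler.isSchwartzRealization_schwartzGenerator hd,
    fun T hT => CauchyMehler.neg_one_mem_approxPointSpectrum hd hT⟩,
    le_antisymm (CauchyMehler.functionalU_le_one hd) (CauchyMehler.one_le_functionalU hd)⟩
  have h := ENNReal.Tendsto.pow (n := 2) (CauchyMehler.tendsto_defectRatio hd j)
  rw [zero_pow two_ne_zero] at h
  refine h.congr fun R => ?_
  rw [CauchyMehler.defectRatio, div_eq_mul_inv, mul_pow, ← ENNReal.inv_pow, ← div_eq_mul_inv]
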